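/- **Theorem (Table of plane cubic curves).** Let $x,y,z$ be coordinates on $\mathbb C^3$. For a complex form $\phi$ of degree $d$, the rank $R(\phi)$ is the least $r$ such that $\phi$ is a sum of $r$ $d$-th powers of linear forms, and the border rank $\underline R(\phi)$ is the least $r$ such that $\phi$ lies in the Zariski closure of the set of degree-$d$ forms of rank at most $r$. For a ternary cubic $\phi$, let $\mathrm{Rker}\,\phi_{1,2}$ be the space of quadratic forms $q$ in the dual variables whose associated differential operator $q(\partial_x,\partial_y,\partial_z)$ annihilates $\phi$, and let $D(\phi)$ be the locus of quadratic forms of rank at most $2$ (the zero locus of the determinant) in $\mathbb P(\mathrm{Rker}\,\phi_{1,2})$. Every nonzero ternary cubic form over $\mathbb C$ can be brought, by an invertible linear change of coordinates, to one of the normal forms in the following table, and every cubic form equivalent to a normal form has the rank and border rank listed there. The curve defined by each normal form is of the type given in the first column. In every row with an entry in the last column, $\mathbb P(\mathrm{Rker}\,\phi_{1,2})$ is a projective plane and $D(\phi)$ is a cubic curve in it (counted with multiplicities) of the type given. \[ \begin{array}{llccl} \text{Description} & \text{normal form } \phi & R & \underline R & D(\phi)\\ \hline \text{triple line} & x^3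 & 1 & 1 & \\ \text{three distinct concurrent lines} & xy(x+y) & 2 & 2 & \\ \text{double line + line} & x^2y & 3 & 2 & \\ \text{irreducible} & y^2z-x^3-z^3 & 3 & 3 & \text{triangle}\\ \text{irreducible} & y^2z-x^3-xz^2 & 4 & 4 & \text{smooth}\\ \text{cusp} & y^2z-x^3 & 4 & 3 & \text{double line + line}\\ \text{triangle} & xyz & 4 & 4 & \text{triangle}\\ \text{conic + transversal line} & x(x^2+yz) & 4 & 4 & \text{conic + transversal line}\\ \text{irreducible, smooth } (a\neq 0,\ a^3\neq -27/4) & y^2z-x^3-axz^2-z^3 & 4 & 4 & \text{irreducible, smooth cubic}\\ \text{irreducible, singular } (a^3=-27/4) & y^2z-x^3-axz^2-z^3 & 4 & 4 & \text{irreducible, singular cubic}\\ \text{conic + tangent line} & y(x^2+yz) & 5 & 3 & \text{triple line} \end{array} \] Here $a\in\mathbb C$, and "conic" means irreducible conic. -/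

import Mathlib

noncomputable section

namespace PlaneCubic

open MvPolynomial

/-- The linear form `∑ i, v i * X i` in `n` variables with coefficient vector `v`. -/
def linearForm {n : ℕ} (v : Fin n → ℂ) : MvPolynomial (Fin n) ℂ :=
  ∑ i, C (v i) * X i

/-- The set of sums of `r` `d`-th powers of linear forms (the zero form is allowed as a summand,
so these are the sums of at most `r` such powers). -/
def powerSums (n d r : ℕ) : Set (MvPolynomial (Fin n) ℂ) :=
  {φ | ∃ l : Fin r → (Fin n → ℂ), φ = ∑ k, linearForm (l k) ^ d}

/-- The Waring rank of a form `φ` of degree `d`: the least `r` such that `φ` is a sum of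
`r` `d`-th powers of linear forms. -/
def waringRank {n : ℕ} (d : ℕ) (φ : MvPolynomial (Fin n) ℂ) : ℕ :=
  sInf {r | φ ∈ powerSums n d r}

/-- The Zariski closure, in the finite-dimensional vector space of forms of degree `d` in
`n` variables, of a set `S` of such forms: the forms at which every polynomial `P` in the
coefficients that vanishes on `S` vanishes. -/
def zariskiClosure (n d : ℕ) (S : Set (MvPolynomial (Fin n) ℂ)) :
    Set (MvPolynomial (Fin n) ℂ) :=
  {φ | φ.IsHomogeneous d ∧ ∀ P : MvPolynomial (Fin n →₀ ℕ) ℂ,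
    (∀ ψ ∈ S, eval (fun m => coeff m ψ) P = 0) → eval (fun m => coeff m φ) P = 0}

/-- The border rank of a form `φ` of degree `d`: the least `r` such that `φ` lies in the
Zariski closure of the set of forms of rank at most `r`. -/
def borderRank {n : ℕ} (d : ℕ) (φ : MvPolynomial (Fin n) ℂ) : ℕ :=
  sInf {r | φ ∈ zariskiClosure n d (powerSums n d r)}

/-- `φ` is obtained from `ψ` by an invertible linear change of the three variables. -/
def LinEquiv (φ ψ : MvPolynomial (Fin 3) ℂ) : Prop :=
  ∃ g : Matrix.GeneralLinearGroup (Fin 3) ℂ,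
    φ = bind₁ (fun i => linearForm (fun j => (g : Matrix (Fin 3) (Fin 3) ℂ) i j)) ψ

/-- The projective plane curve `F = 0` has no singular point. -/
def SmoothCurve (F : MvPolynomial (Fin 3) ℂ) : Prop :=
  ∀ p : Fin 3 → ℂ, p ≠ 0 → eval p F = 0 → ∃ i, eval p (pderiv i F) ≠ 0

/-- The Hessian matrix of `F` at the point `p`. -/
def hessianAt (F : MvPolynomial (Fin 3) ℂ) (p : Fin 3 → ℂ) : Matrix (Fin 3) (Fin 3) ℂ :=
  Matrix.of fun i j => eval p (pderiv i (pderiv j F))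

/-- The geometric types of plane cubic curves that occur. -/
inductive CurveType where
  | tripleLine
  | threeConcurrentLines
  | doubleLinePlusLine
  | triangle
  | conicPlusTransversalLine
  | conicPlusTangentLine
  | irreducible
  | smooth
  | irreducibleSmooth
  | irreducibleSingular
  | cusp

/-- `T.Describes F`: the plane cubic with equation `F = 0` (as a divisor, that is, with
multiplicities) is of type `T`. -/
def CurveType.Describes : CurveType → MvPolynomial (Fin 3) ℂ → Prop
  | .tripleLine, F => ∃ l : Fin 3 → ℂ, l ≠ 0 ∧ F = linearForm l ^ 3
  | .threeConcurrentLines, F => ∃ l₁ l₂ l₃ : Fin 3 → ℂ,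
      LinearIndependent ℂ ![l₁, l₂] ∧ LinearIndependent ℂ ![l₁, l₃] ∧
      LinearIndependent ℂ ![l₂, l₃] ∧ (∃ p : Fin 3 → ℂ, p ≠ 0 ∧
        eval p (linearForm l₁) = 0 ∧ eval p (linearForm l₂) = 0 ∧ eval p (linearForm l₃) = 0) ∧
      F = linearForm l₁ * linearForm l₂ * linearForm l₃
  | .doubleLinePlusLine, F => ∃ l m : Fin 3 → ℂ,
      LinearIndependent ℂ ![l, m] ∧ F = linearForm l ^ 2 * linearForm m
  | .triangle, F => ∃ l₁ l₂ l₃ : Fin 3 → ℂ,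
      LinearIndependent ℂ ![l₁, l₂, l₃] ∧ F = linearForm l₁ * linearForm l₂ * linearForm l₃
  -- an irreducible conic and a line that meets it in two distinct points
  | .conicPlusTransversalLine, F => ∃ (l : Fin 3 → ℂ) (q : MvPolynomial (Fin 3) ℂ),
      l ≠ 0 ∧ q.IsHomogeneous 2 ∧ Irreducible q ∧ F = linearForm l * q ∧
      ∃ p₁ p₂ : Fin 3 → ℂ, LinearIndependent ℂ ![p₁, p₂] ∧
        eval p₁ (linearForm l) = 0 ∧ eval p₁ q = 0 ∧ eval p₂ (linearForm l) = 0 ∧ eval p₂ q = 0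
  -- an irreducible conic and a line that meets it in exactly one point
  | .conicPlusTangentLine, F => ∃ (l : Fin 3 → ℂ) (q : MvPolynomial (Fin 3) ℂ),
      l ≠ 0 ∧ q.IsHomogeneous 2 ∧ Irreducible q ∧ F = linearForm l * q ∧
      ∃ p : Fin 3 → ℂ, p ≠ 0 ∧ eval p (linearForm l) = 0 ∧ eval p q = 0 ∧
        ∀ p' : Fin 3 → ℂ, eval p' (linearForm l) = 0 → eval p' q = 0 → ∃ c : ℂ, p' = c • p
  | .irreducible, F => Irreducible F
  | .smooth, F => SmoothCurve F
  | .irreducibleSmooth, F => Irreducible F ∧ SmoothCurve F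
  | .irreducibleSingular, F => Irreducible F ∧ ¬ SmoothCurve F
  -- irreducible, with a double point whose tangent cone is a double line
  | .cusp, F => Irreducible F ∧ ∃ p : Fin 3 → ℂ, p ≠ 0 ∧
      (∀ i, eval p (pderiv i F) = 0) ∧ (hessianAt F p).rank = 1

/-- The right kernel of `φ₁,₂` for a ternary cubic `φ`: the quadratic forms on the dual
variables, given by their symmetric matrices `Q`, whose differential operator
`∑ i j, Q i j ∂ᵢ ∂ⱼ` annihilates `φ`. -/
def rightKernel (φ : MvPolynomial (Fin 3) ℂ) : Submodule ℂ (Matrix (Fin 3) (Fin 3) ℂ) where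
  carrier := {Q | Q.transpose = Q ∧ ∑ i, ∑ j, Q i j • pderiv i (pderiv j φ) = 0}
  zero_mem' := by simp
  add_mem' := by
    rintro P Q ⟨hP, hP'⟩ ⟨hQ, hQ'⟩
    refine ⟨by rw [Matrix.transpose_add, hP, hQ], ?_⟩
    simp only [Matrix.add_apply, add_smul, Finset.sum_add_distrib, hP', hQ', add_zero]
  smul_mem' := by
    rintro c Q ⟨hQ, hQ'⟩
    refine ⟨by rw [Matrix.transpose_smul, hQ], ?_⟩
    simp only [Matrix.smul_apply, smul_assoc, ← Finset.smul_sum, hQ', smul_zero]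

/-- The equation, in the coordinates given by a basis `b` of `rightKernel φ`, of the locus of
quadratic forms of rank at most two in the projectivization of `rightKernel φ`. -/
def degenerateLocus {φ : MvPolynomial (Fin 3) ℂ} (b : Module.Basis (Fin 3) ℂ (rightKernel φ)) :
    MvPolynomial (Fin 3) ℂ :=
  (∑ k, (X k : MvPolynomial (Fin 3) ℂ) •
    ((b k : Matrix (Fin 3) (Fin 3) ℂ).map (C : ℂ → MvPolynomial (Fin 3) ℂ))).det

/-- `P(Rker φ₁,₂)` is a projective plane, and its intersection with the variety of quadratic
forms of rank at most two is a cubic curve of type `T`. -/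
def DegenerateLocusIs (φ : MvPolynomial (Fin 3) ℂ) (T : CurveType) : Prop :=
  Module.finrank ℂ (rightKernel φ) = 3 ∧
    ∀ b : Module.Basis (Fin 3) ℂ (rightKernel φ), T.Describes (degenerateLocus b)

/-- A row of the table of plane cubic curves; `locus` is the type of the intersection of
`P(Rker φ₁,₂)` with the quadratic forms of rank at most two, `none` where the table is blank. -/
structure Row where
  description : CurveType
  normalForm : MvPolynomial (Fin 3) ℂ
  rank : ℕ
  border : ℕ
  locus : Option CurveType

/-- The table of plane cubic curves, in the variables `x, y, z = X 0, X 1, X 2`. The last two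
clauses are families of rows indexed by a complex parameter `a`. -/
inductive Table : Row → Prop
  | tripleLine : Table ⟨.tripleLine, X 0 ^ 3, 1, 1, none⟩
  | threeConcurrentLines : Table ⟨.threeConcurrentLines, X 0 * X 1 * (X 0 + X 1), 2, 2, none⟩
  | doubleLinePlusLine : Table ⟨.doubleLinePlusLine, X 0 ^ 2 * X 1, 3, 2, none⟩
  | irreducible₁ : Table ⟨.irreducible, X 1 ^ 2 * X 2 - X 0 ^ 3 - X 2 ^ 3, 3, 3, some .triangle⟩
  | irreducible₂ : Table ⟨.irreducible, X 1 ^ 2 * X 2 - X 0 ^ 3 - X 0 * X 2 ^ 2, 4, 4, some .smooth⟩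
  | cusp : Table ⟨.cusp, X 1 ^ 2 * X 2 - X 0 ^ 3, 4, 3, some .doubleLinePlusLine⟩
  | triangle : Table ⟨.triangle, X 0 * X 1 * X 2, 4, 4, some .triangle⟩
  | conicPlusTransversalLine : Table ⟨.conicPlusTransversalLine, X 0 * (X 0 ^ 2 + X 1 * X 2), 4, 4,
      some .conicPlusTransversalLine⟩
  | conicPlusTangentLine : Table ⟨.conicPlusTangentLine, X 1 * (X 0 ^ 2 + X 1 * X 2), 5, 3,
      some .tripleLine⟩
  | irreducibleSmooth (a : ℂ) (ha : a ≠ 0) (ha' : a ^ 3 ≠ -27 / 4) :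
      Table ⟨.irreducibleSmooth, X 1 ^ 2 * X 2 - X 0 ^ 3 - C a * X 0 * X 2 ^ 2 - X 2 ^ 3, 4, 4,
        some .irreducibleSmooth⟩
  | irreducibleSingular (a : ℂ) (ha : a ^ 3 = -27 / 4) :
      Table ⟨.irreducibleSingular, X 1 ^ 2 * X 2 - X 0 ^ 3 - C a * X 0 * X 2 ^ 2 - X 2 ^ 3, 4, 4,
        some .irreducibleSingular⟩

end PlaneCubic

end

noncomputable section

namespace PlaneCubic

open MvPolynomial

/-! Border rank is bounded below by polynomials in the coefficients that vanish on sums of few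
cubes: one coefficient, a 2×2 or 3×3 minor of the catalecticant, and for three cubes the Aronhold
invariant. Explicit sums of cubes bound the rank from above, and where the two bounds meet, both
numbers are known (`rank_and_borderRank_eq_succ`). In the three rows where they differ, the border
rank comes from a difference quotient of cubes that tends to the form
(`mem_zariskiClosure_of_family`). There the lower bound on the rank uses apolarity: if φ = ∑ lₖ³ and
q annihilates φ, then ∑ q(lₖ) lₖ = 0. Too many annihilating quadrics would give more linear
relations than the lₖ allow.

The degenerate locus is the determinant of a general element of the kernel. A change of basis is a
linear substitution, so one basis suffices (`degenerateLocusIs_of_basis`). For a cubic in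
Weierstrass form the determinant is again in Weierstrass form, which settles all these rows by one
computation.

For the classification, the curve meets its Hessian curve in a point p (`exists_common_zero`), and a
vector v ≠ 0 lies in the kernel of the Hessian matrix at p. If v is proportional to p, Euler's
relation makes p singular. Otherwise Taylor's formula gives F(p + tv) = t³F(v), so the line pv is an
inflectional tangent or a component. An inflectional tangent at a smooth point leads to Weierstrass
form unless the line is a component, and in that case the curve is singular. A cubic with a singular
point is sorted by its tangent cone there: zero, a double line, or two lines
(`hasNormalForm_singularCubic`). -/

/-! ### Common zeros of two ternary polynomials -/

/-- Two polynomials in three variables that vanish at the origin have another common zero. -/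
theorem exists_common_zero (F H : MvPolynomial (Fin 3) ℂ) (hF : eval 0 F = 0)
    (hH : eval 0 H = 0) : ∃ p : Fin 3 → ℂ, p ≠ 0 ∧ eval p F = 0 ∧ eval p H = 0 := by
  by_contra! hno
  -- Kernels of the substitutions that set more and more variables to 0 form a chain of primes (0) ⊂
  -- (X₀) ⊂ (X₀, X₁) ⊂ (X₀, X₁, X₂), so the ideal of the origin has height at least 3.
  let e (s : Fin 3 → MvPolynomial (Fin 3) ℂ) : Ideal (MvPolynomial (Fin 3) ℂ) :=
    RingHom.ker (aeval s : MvPolynomial (Fin 3) ℂ →ₐ[ℂ] MvPolynomial (Fin 3) ℂ)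
  have he (s) : (e s).IsPrime := RingHom.ker_isPrime _
  have hlt (s t : Fin 3 → MvPolynomial (Fin 3) ℂ) (i : Fin 3) (hi : t i = 0) (hs : s i ≠ 0)
      (hst : ∀ j, t j = aeval t (s j)) : e s < e t := by
    refine lt_of_le_not_ge ?_ fun h => hs ?_
    · intro P hP
      have hcomp : (aeval t : MvPolynomial (Fin 3) ℂ →ₐ[ℂ] MvPolynomial (Fin 3) ℂ) =
          (aeval t).comp (aeval s) := by
        ext1 j
        simpa using hst j
      have hP' : aeval s P = 0 := hP
      change aeval t P = 0
      rw [hcomp, AlgHom.comp_apply, hP', map_zero]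
    · have : (X i : MvPolynomial (Fin 3) ℂ) ∈ e s := h (by simp [e, hi])
      simpa [e] using this
  have h₁ : e ![X 0, X 1, X 2] < e ![0, X 1, X 2] :=
    hlt _ _ 0 rfl (X_ne_zero _) (by intro j; fin_cases j <;> simp)
  have h₂ : e ![0, X 1, X 2] < e ![0, 0, X 2] :=
    hlt _ _ 1 rfl (X_ne_zero _) (by intro j; fin_cases j <;> simp)
  have h₃ : e ![0, 0, X 2] < e ![0, 0, 0] :=
    hlt _ _ 2 rfl (X_ne_zero _) (by intro j; fin_cases j <;> simp)
  have := he ![X 0, X 1, X 2]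
  have := he ![0, X 1, X 2]
  have := he ![0, 0, X 2]
  have := he ![0, 0, 0]
  have mem_e (P : MvPolynomial (Fin 3) ℂ) : P ∈ e ![0, 0, 0] ↔ eval 0 P = 0 := by
    have h0 : (aeval ![0, 0, 0] : MvPolynomial (Fin 3) ℂ →ₐ[ℂ] MvPolynomial (Fin 3) ℂ) =
        (Algebra.ofId ℂ _).comp (aeval (0 : Fin 3 → ℂ)) := by
      ext1 j
      fin_cases j <;> simp
    change aeval ![0, 0, 0] P = 0 ↔ _
    rw [h0, AlgHom.comp_apply, Algebra.ofId_apply, MvPolynomial.algebraMap_eq, C_eq_zero,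
      MvPolynomial.aeval_eq_eval]
  have hheight : (3 : ℕ∞) ≤ (e ![0, 0, 0]).height := by
    have a₁ := Ideal.height_add_one_le_of_lt_of_isPrime h₁
    have a₂ := Ideal.height_add_one_le_of_lt_of_isPrime h₂
    have a₃ := Ideal.height_add_one_le_of_lt_of_isPrime h₃
    calc (3 : ℕ∞) = 0 + 1 + 1 + 1 := by norm_num
      _ ≤ (e ![X 0, X 1, X 2]).height + 1 + 1 + 1 := by gcongr; exact zero_le
      _ ≤ (e ![0, X 1, X 2]).height + 1 + 1 := by gcongr
      _ ≤ (e ![0, 0, X 2]).height + 1 := by gcongr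
      _ ≤ _ := a₃
  -- By the Nullstellensatz, if the origin is the only common zero, then the radical of (F, H) is
  -- the ideal of the origin.
  have hrad : (Ideal.span {F, H}).radical = e ![0, 0, 0] := by
    rw [← vanishingIdeal_zeroLocus_eq_radical (K := ℂ), zeroLocus_span]
    ext P
    rw [mem_e]
    constructor
    · intro h
      refine h 0 ?_
      rintro Q (rfl | rfl)
      exacts [hF, hH]
    · intro h x hx
      have hx' : eval x F = 0 ∧ eval x H = 0 := by
        simpa [MvPolynomial.aeval_eq_eval] using hx
      have : x = 0 := by
        by_contra hx0
        exact hno x hx0 hx'.1 hx'.2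
      simpa [this, MvPolynomial.aeval_eq_eval] using h
  have hmin : e ![0, 0, 0] ∈ (Ideal.span {F, H}).minimalPrimes := by
    refine ⟨⟨inferInstance, hrad ▸ Ideal.le_radical⟩, fun Q hQ _ => ?_⟩
    rw [← hrad]
    exact (Ideal.IsPrime.radical_le_iff hQ.1).2 hQ.2
  -- Krull's height theorem: a minimal prime over two generators has height at most 2.
  have hle := Ideal.height_le_card_of_mem_minimalPrimes_span (Set.toFinite _) hmin
  have h2 : (({F, H} : Set (MvPolynomial (Fin 3) ℂ)).ncard : ℕ∞) ≤ 2 := by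
    exact_mod_cast (Set.ncard_insert_le F {H}).trans (by rw [Set.ncard_singleton])
  exact absurd (hheight.trans (hle.trans h2)) (by decide)

/-! ### Linear changes of coordinates -/

theorem eval_linearForm {n : ℕ} (v p : Fin n → ℂ) : eval p (linearForm v) = ∑ i, v i * p i := by
  simp [linearForm]

theorem eval_bind₁_linearForm {n : ℕ} (M : Matrix (Fin n) (Fin n) ℂ) (ψ : MvPolynomial (Fin n) ℂ)
    (p : Fin n → ℂ) :
    eval p (bind₁ (fun i => linearForm (fun j => M i j)) ψ) = eval (M.mulVec p) ψ := by
  have h : (fun i => aeval p (linearForm (fun j => M i j))) = M.mulVec p := by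
    funext i
    rw [MvPolynomial.aeval_eq_eval]
    exact eval_linearForm _ _
  have := aeval_bind₁ p (fun i => linearForm (fun j => M i j)) ψ
  rwa [h, MvPolynomial.aeval_eq_eval, MvPolynomial.aeval_eq_eval] at this

/-- Over an infinite field a polynomial is determined by its values. Equivalences can thus be
checked pointwise, which reduces each explicit one to a ring identity. -/
theorem linEquiv_iff {φ ψ : MvPolynomial (Fin 3) ℂ} :
    LinEquiv φ ψ ↔
      ∃ M : Matrix (Fin 3) (Fin 3) ℂ, M.det ≠ 0 ∧ ∀ p, eval p φ = eval (M.mulVec p) ψ := by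
  constructor
  · rintro ⟨g, rfl⟩
    exact ⟨g, g.det_ne_zero, eval_bind₁_linearForm _ _⟩
  · rintro ⟨M, hM, h⟩
    refine ⟨Matrix.GeneralLinearGroup.mkOfDetNeZero M hM, MvPolynomial.funext fun p => ?_⟩
    rw [h, eval_bind₁_linearForm]
    rfl

theorem LinEquiv.refl (φ : MvPolynomial (Fin 3) ℂ) : LinEquiv φ φ :=
  linEquiv_iff.2 ⟨1, by simp, by simp⟩

theorem LinEquiv.symm {φ ψ : MvPolynomial (Fin 3) ℂ} (h : LinEquiv φ ψ) : LinEquiv ψ φ := by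
  obtain ⟨M, hM, h⟩ := linEquiv_iff.1 h
  refine linEquiv_iff.2 ⟨M⁻¹, ?_, fun p => ?_⟩
  · simpa using hM
  · rw [h, Matrix.mulVec_mulVec, Matrix.mul_nonsing_inv _ (isUnit_iff_ne_zero.2 hM),
      Matrix.one_mulVec]

theorem LinEquiv.trans {φ ψ χ : MvPolynomial (Fin 3) ℂ} (h : LinEquiv φ ψ) (h' : LinEquiv ψ χ) :
    LinEquiv φ χ := by
  obtain ⟨M, hM, h⟩ := linEquiv_iff.1 h
  obtain ⟨N, hN, h'⟩ := linEquiv_iff.1 h'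
  refine linEquiv_iff.2 ⟨N * M, ?_, fun p => ?_⟩
  · rw [Matrix.det_mul]
    exact mul_ne_zero hN hM
  · rw [h, h', Matrix.mulVec_mulVec]

theorem bind₁_linearForm (M : Matrix (Fin 3) (Fin 3) ℂ) (l : Fin 3 → ℂ) :
    bind₁ (fun i => linearForm (fun j => M i j)) (linearForm l) = linearForm (Matrix.vecMul l M) :=
  MvPolynomial.funext fun p => by
    rw [eval_bind₁_linearForm, eval_linearForm, eval_linearForm]
    exact Matrix.dotProduct_mulVec l M p

/-! ### Ternary cubics in coordinates -/

/-- The exponents of the monomials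
`x³, y³, z³, x²y, x²z, xy², y²z, xz², yz², xyz`. -/
def cubicExponent : Fin 10 → Fin 3 → ℕ :=
  ![![3, 0, 0], ![0, 3, 0], ![0, 0, 3], ![2, 1, 0], ![2, 0, 1], ![1, 2, 0], ![0, 2, 1],
    ![1, 0, 2], ![0, 1, 2], ![1, 1, 1]]

/-- The ternary cubic monomials. -/
def cubicMonomial (i : Fin 10) : Fin 3 →₀ ℕ :=
  Finsupp.equivFunOnFinite.symm (cubicExponent i)

theorem cubicMonomial_injective : Function.Injective cubicMonomial :=
  Finsupp.equivFunOnFinite.symm.injective.comp (by decide : Function.Injective cubicExponent)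

theorem exists_cubicMonomial_eq {m : Fin 3 →₀ ℕ} (hm : m.degree = 3) :
    ∃ i, cubicMonomial i = m := by
  have h3 : m 0 + m 1 + m 2 = 3 := by
    rwa [Finsupp.degree_eq_sum, Fin.sum_univ_three] at hm
  have key : ∀ a b c : Fin 4, a.val + b.val + c.val = 3 →
      ∃ i, cubicExponent i = ![a.val, b.val, c.val] := by decide
  obtain ⟨i, hi⟩ := key ⟨m 0, by omega⟩ ⟨m 1, by omega⟩ ⟨m 2, by omega⟩ h3
  refine ⟨i, Finsupp.ext fun j => ?_⟩
  change cubicExponent i j = m j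
  rw [hi]
  fin_cases j <;> rfl

/-- The ternary cubic with the given coefficients. -/
def ternaryCubic (c : Fin 10 → ℂ) : MvPolynomial (Fin 3) ℂ :=
  ∑ i, monomial (cubicMonomial i) (c i)

theorem coeff_ternaryCubic (c : Fin 10 → ℂ) (m : Fin 3 →₀ ℕ) :
    coeff m (ternaryCubic c) = ∑ i, if cubicMonomial i = m then c i else 0 := by
  simp [ternaryCubic, coeff_sum, coeff_monomial]

@[simp]
theorem coeff_cubicMonomial (c : Fin 10 → ℂ) (i : Fin 10) :
    coeff (cubicMonomial i) (ternaryCubic c) = c i := by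
  simp [coeff_ternaryCubic, cubicMonomial_injective.eq_iff]

theorem isHomogeneous_ternaryCubic (c : Fin 10 → ℂ) : (ternaryCubic c).IsHomogeneous 3 := by
  refine IsHomogeneous.sum _ _ _ fun i _ => isHomogeneous_monomial _ ?_
  rw [Finsupp.degree_eq_sum]
  revert i
  decide

theorem eq_ternaryCubic {φ : MvPolynomial (Fin 3) ℂ} (h : φ.IsHomogeneous 3) :
    φ = ternaryCubic fun i => coeff (cubicMonomial i) φ := by
  ext m
  by_cases hm : m.degree = 3
  · obtain ⟨i, rfl⟩ := exists_cubicMonomial_eq hm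
    simp
  · rw [h.coeff_eq_zero hm, (isHomogeneous_ternaryCubic _).coeff_eq_zero hm]

theorem eval_ternaryCubic (c : Fin 10 → ℂ) (p : Fin 3 → ℂ) :
    eval p (ternaryCubic c) = c 0 * p 0 ^ 3 + c 1 * p 1 ^ 3 + c 2 * p 2 ^ 3
      + c 3 * p 0 ^ 2 * p 1 + c 4 * p 0 ^ 2 * p 2 + c 5 * p 0 * p 1 ^ 2 + c 6 * p 1 ^ 2 * p 2
      + c 7 * p 0 * p 2 ^ 2 + c 8 * p 1 * p 2 ^ 2 + c 9 * p 0 * p 1 * p 2 := by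
  have h (i : Fin 10) : eval p (monomial (cubicMonomial i) (c i)) =
      c i * (p 0 ^ cubicExponent i 0 * p 1 ^ cubicExponent i 1 * p 2 ^ cubicExponent i 2) := by
    rw [eval_monomial, Finsupp.prod_fintype _ _ (by simp), Fin.prod_univ_three]
    rfl
  rw [ternaryCubic, map_sum, Finset.sum_congr rfl fun i _ => h i]
  simp [Fin.sum_univ_succ, cubicExponent]
  ring

theorem ternaryCubic_eq_iff {c : Fin 10 → ℂ} {φ : MvPolynomial (Fin 3) ℂ} :
    φ = ternaryCubic c ↔ ∀ x y z : ℂ, eval ![x, y, z] φ = eval ![x, y, z] (ternaryCubic c) := by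
  refine ⟨by rintro rfl; simp, fun h => MvPolynomial.funext fun p => ?_⟩
  have hp : p = ![p 0, p 1, p 2] := by
    ext i
    fin_cases i <;> rfl
  rw [hp]
  exact h _ _ _

/-! ### Invariance of rank and border rank -/

theorem mem_powerSums_of_linEquiv {d r : ℕ} {φ ψ : MvPolynomial (Fin 3) ℂ} (h : LinEquiv φ ψ)
    (hψ : ψ ∈ powerSums 3 d r) : φ ∈ powerSums 3 d r := by
  obtain ⟨g, rfl⟩ := h
  obtain ⟨l, rfl⟩ := hψ
  exact ⟨fun k => Matrix.vecMul (l k) g, by simp [bind₁_linearForm]⟩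

theorem isHomogeneous_linearForm {n : ℕ} (v : Fin n → ℂ) : (linearForm v).IsHomogeneous 1 :=
  IsHomogeneous.sum _ _ _ fun i _ => by simpa using (isHomogeneous_C _ (v i)).mul (isHomogeneous_X ℂ i)

theorem isHomogeneous_of_mem_powerSums {n d r : ℕ} {φ : MvPolynomial (Fin n) ℂ}
    (h : φ ∈ powerSums n d r) : φ.IsHomogeneous d := by
  obtain ⟨l, rfl⟩ := h
  exact IsHomogeneous.sum _ _ _ fun k _ => by simpa using (isHomogeneous_linearForm (l k)).pow d

theorem LinEquiv.isHomogeneous {d : ℕ} {φ ψ : MvPolynomial (Fin 3) ℂ} (h : LinEquiv φ ψ)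
    (hψ : ψ.IsHomogeneous d) : φ.IsHomogeneous d := by
  obtain ⟨g, rfl⟩ := h
  simpa using hψ.aeval _ fun i => isHomogeneous_linearForm _

/-- A change of variables T acts linearly on the coefficients of cubics, so an equation P pulls back
to an equation `P'` with P'(θ) = P(Tθ). Since T preserves sums of r cubes, `P'` vanishes on them
whenever P does. -/
theorem mem_zariskiClosure_of_linEquiv {r : ℕ} {φ ψ : MvPolynomial (Fin 3) ℂ}
    (h : LinEquiv φ ψ) (hψ : ψ ∈ zariskiClosure 3 3 (powerSums 3 3 r)) :
    φ ∈ zariskiClosure 3 3 (powerSums 3 3 r) := by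
  refine ⟨h.isHomogeneous hψ.1, fun P hP => ?_⟩
  obtain ⟨g, rfl⟩ := h
  set T := bind₁ (fun i => linearForm (fun j => (g : Matrix (Fin 3) (Fin 3) ℂ) i j))
  let P' : MvPolynomial (Fin 3 →₀ ℕ) ℂ := bind₁ (fun m => ∑ i,
    C (coeff m (T (monomial (cubicMonomial i) 1))) * X (cubicMonomial i)) P
  have key (θ : MvPolynomial (Fin 3) ℂ) (hθ : θ.IsHomogeneous 3) :
      eval (fun m => coeff m θ) P' = eval (fun m => coeff m (T θ)) P := by
    have h1 := aeval_bind₁ (fun m => coeff m θ) (fun m => ∑ i,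
      C (coeff m (T (monomial (cubicMonomial i) 1))) * X (cubicMonomial i)) P
    rw [MvPolynomial.aeval_eq_eval] at h1
    refine h1.trans ?_
    rw [MvPolynomial.aeval_eq_eval]
    congr 2
    funext m
    conv_rhs => rw [eq_ternaryCubic hθ, ternaryCubic, map_sum, coeff_sum]
    rw [map_sum]
    refine Finset.sum_congr rfl fun i _ => ?_
    have hi : monomial (cubicMonomial i) (coeff (cubicMonomial i) θ) =
        coeff (cubicMonomial i) θ • monomial (cubicMonomial i) (1 : ℂ) := by
      rw [smul_monomial, smul_eq_mul, mul_one]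
    rw [hi, map_smul, coeff_smul]
    simp [mul_comm]
  rw [← key ψ hψ.1]
  refine hψ.2 P' fun θ hθ => ?_
  rw [key θ (isHomogeneous_of_mem_powerSums hθ)]
  exact hP _ (mem_powerSums_of_linEquiv ⟨g, rfl⟩ hθ)

theorem LinEquiv.waringRank_eq {φ ψ : MvPolynomial (Fin 3) ℂ} (h : LinEquiv φ ψ) :
    waringRank 3 φ = waringRank 3 ψ := by
  unfold waringRank
  congr 1
  ext r
  exact ⟨mem_powerSums_of_linEquiv h.symm, mem_powerSums_of_linEquiv h⟩

theorem LinEquiv.borderRank_eq {φ ψ : MvPolynomial (Fin 3) ℂ} (h : LinEquiv φ ψ) :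
    borderRank 3 φ = borderRank 3 ψ := by
  unfold borderRank
  congr 1
  ext r
  exact ⟨mem_zariskiClosure_of_linEquiv h.symm, mem_zariskiClosure_of_linEquiv h⟩

/-! ### Criteria for rank and border rank -/

/-- The coefficients of the cube of a ternary linear form. -/
def cubeCoeff (v : Fin 3 → ℂ) : Fin 10 → ℂ :=
  ![v 0 ^ 3, v 1 ^ 3, v 2 ^ 3, 3 * v 0 ^ 2 * v 1, 3 * v 0 ^ 2 * v 2, 3 * v 0 * v 1 ^ 2,
    3 * v 1 ^ 2 * v 2, 3 * v 0 * v 2 ^ 2, 3 * v 1 * v 2 ^ 2, 6 * v 0 * v 1 * v 2]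

theorem linearForm_pow_three (v : Fin 3 → ℂ) : linearForm v ^ 3 = ternaryCubic (cubeCoeff v) := by
  refine MvPolynomial.funext fun p => ?_
  rw [map_pow, eval_linearForm, eval_ternaryCubic, Fin.sum_univ_three]
  simp [cubeCoeff]
  ring

theorem coeff_of_mem_powerSums {r : ℕ} {φ : MvPolynomial (Fin 3) ℂ} (h : φ ∈ powerSums 3 3 r) :
    ∃ l : Fin r → Fin 3 → ℂ, ∀ i, coeff (cubicMonomial i) φ = ∑ k, cubeCoeff (l k) i := by
  obtain ⟨l, rfl⟩ := h
  exact ⟨l, fun i => by simp [coeff_sum, linearForm_pow_three]⟩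

theorem powerSums_mono {r s : ℕ} (h : r ≤ s) : powerSums 3 3 r ⊆ powerSums 3 3 s := by
  refine monotone_nat_of_le_succ (f := powerSums 3 3) (fun n => ?_) h
  rintro _ ⟨l, rfl⟩
  refine ⟨Fin.snoc l 0, ?_⟩
  simp [Fin.sum_univ_castSucc, linearForm]

theorem zariskiClosure_mono {S T : Set (MvPolynomial (Fin 3) ℂ)} (h : S ⊆ T) :
    zariskiClosure 3 3 S ⊆ zariskiClosure 3 3 T :=
  fun _ hφ => ⟨hφ.1, fun P hP => hφ.2 P fun ψ hψ => hP ψ (h hψ)⟩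

theorem powerSums_subset_zariskiClosure (r : ℕ) :
    powerSums 3 3 r ⊆ zariskiClosure 3 3 (powerSums 3 3 r) :=
  fun φ hφ => ⟨isHomogeneous_of_mem_powerSums hφ, fun _ hP => hP φ hφ⟩

/-- The witness `h` makes the set nonempty, so the default value `sInf ∅ = 0` plays no role. -/
theorem sInf_eq_succ {p : ℕ → Prop} {r : ℕ} (h : p (r + 1)) (h' : ¬ p r)
    (hmono : ∀ s ≤ r, p s → p r) : sInf {s | p s} = r + 1 := by
  refine le_antisymm (Nat.sInf_le h) (le_csInf ⟨_, h⟩ fun s hs => ?_)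
  by_contra hlt
  exact h' (hmono s (by omega) hs)

theorem waringRank_eq_succ {r : ℕ} {φ : MvPolynomial (Fin 3) ℂ} (h : φ ∈ powerSums 3 3 (r + 1))
    (h' : φ ∉ powerSums 3 3 r) : waringRank 3 φ = r + 1 :=
  sInf_eq_succ h h' fun _ hs hφ => powerSums_mono hs hφ

theorem borderRank_eq_succ {r : ℕ} {φ : MvPolynomial (Fin 3) ℂ}
    (h : φ ∈ zariskiClosure 3 3 (powerSums 3 3 (r + 1)))
    (h' : φ ∉ zariskiClosure 3 3 (powerSums 3 3 r)) : borderRank 3 φ = r + 1 :=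
  sInf_eq_succ h h' fun _ hs hφ => zariskiClosure_mono (powerSums_mono hs) hφ

theorem rank_and_borderRank_eq_succ {r : ℕ} {φ : MvPolynomial (Fin 3) ℂ}
    (h : φ ∈ powerSums 3 3 (r + 1)) (h' : φ ∉ zariskiClosure 3 3 (powerSums 3 3 r)) :
    waringRank 3 φ = r + 1 ∧ borderRank 3 φ = r + 1 :=
  ⟨waringRank_eq_succ h fun hφ => h' (powerSums_subset_zariskiClosure r hφ),
    borderRank_eq_succ (powerSums_subset_zariskiClosure _ h) h'⟩

/-- Scalar weights are harmless: each is a cube in ℂ and is absorbed into its linear form. -/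
theorem mem_powerSums_of_eval {r : ℕ} {φ : MvPolynomial (Fin 3) ℂ} (α : Fin r → ℂ)
    (l : Fin r → Fin 3 → ℂ)
    (h : ∀ x y z, eval ![x, y, z] φ = ∑ k, α k * (l k 0 * x + l k 1 * y + l k 2 * z) ^ 3) :
    φ ∈ powerSums 3 3 r := by
  have hroot (k) : ∃ β : ℂ, β ^ 3 = α k := IsAlgClosed.exists_pow_nat_eq _ (by norm_num)
  choose β hβ using hroot
  refine ⟨fun k => β k • l k, MvPolynomial.funext fun p => ?_⟩
  have hp : p = ![p 0, p 1, p 2] := by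
    ext i
    fin_cases i <;> rfl
  conv_lhs => rw [hp, h]
  rw [map_sum]
  refine Finset.sum_congr rfl fun k _ => ?_
  rw [map_pow, eval_linearForm, Fin.sum_univ_three, ← hβ]
  simp only [Pi.smul_apply, smul_eq_mul]
  ring

/-- A polynomial in the coefficients is continuous along the family. If it vanishes for all t ≠ 0,
it vanishes at t = 0 by density. -/
theorem mem_zariskiClosure_of_family {r : ℕ} (c : ℂ → Fin 10 → ℂ) (hc : ∀ i, Continuous (c · i))
    (h : ∀ t ≠ 0, ternaryCubic (c t) ∈ powerSums 3 3 r) :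
    ternaryCubic (c 0) ∈ zariskiClosure 3 3 (powerSums 3 3 r) := by
  refine ⟨isHomogeneous_ternaryCubic _, fun P hP => ?_⟩
  have hcont : Continuous fun t => eval (fun m => coeff m (ternaryCubic (c t))) P := by
    refine (MvPolynomial.continuous_eval P).comp (continuous_pi fun m => ?_)
    simp only [coeff_ternaryCubic]
    refine continuous_finsetSum _ fun i _ => ?_
    split_ifs
    exacts [hc i, continuous_const]
  have hzero : Set.EqOn (fun t => eval (fun m => coeff m (ternaryCubic (c t))) P) (fun _ => 0)
      {0}ᶜ := fun t ht => hP _ (h t ht)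
  exact congrFun (hcont.ext_on (dense_compl_singleton 0) continuous_const hzero) 0

theorem notMem_zariskiClosure {r : ℕ} {c : Fin 10 → ℂ} (P : MvPolynomial (Fin 10) ℂ)
    (hP : ∀ l : Fin r → Fin 3 → ℂ, eval (fun i => ∑ k, cubeCoeff (l k) i) P = 0)
    (hc : eval c P ≠ 0) : ternaryCubic c ∉ zariskiClosure 3 3 (powerSums 3 3 r) := by
  intro h
  have key (φ : MvPolynomial (Fin 3) ℂ) : eval (fun m => coeff m φ) (rename cubicMonomial P) =
      eval (fun i => coeff (cubicMonomial i) φ) P := by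
    rw [eval_rename]
    rfl
  refine hc ?_
  have := h.2 (rename cubicMonomial P) fun ψ hψ => ?_
  · simpa [key] using this
  · obtain ⟨l, hl⟩ := coeff_of_mem_powerSums hψ
    simp only [key, hl]
    exact hP l

/-! ### Lower bounds for border rank -/

theorem ternaryCubic_notMem_zariskiClosure_zero {c : Fin 10 → ℂ} (hc : c 0 ≠ 0) :
    ternaryCubic c ∉ zariskiClosure 3 3 (powerSums 3 3 0) :=
  notMem_zariskiClosure (X 0) (by simp) (by simpa using hc)

/-- For a single cube, the coefficients of x³, x²y, xy² without their binomial factors are in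
geometric progression. -/
theorem ternaryCubic_notMem_zariskiClosure_one {c : Fin 10 → ℂ} (hc : c 3 ^ 2 - 3 * c 0 * c 5 ≠ 0) :
    ternaryCubic c ∉ zariskiClosure 3 3 (powerSums 3 3 1) :=
  notMem_zariskiClosure (X 3 ^ 2 - C 3 * X 0 * X 5)
    (fun l => by simp [cubeCoeff]; ring) (by simpa using hc)

/-- The minor of the catalecticant matrix with columns `x², y², yz` obstructs border rank two. -/
theorem ternaryCubic_notMem_zariskiClosure_two {c : Fin 10 → ℂ}
    (hc : !![3 * c 0, c 5, c 9; c 3, 3 * c 1, 2 * c 6; c 4, c 6, 2 * c 8].det ≠ 0) :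
    ternaryCubic c ∉ zariskiClosure 3 3 (powerSums 3 3 2) := by
  -- Up to a scalar, the columns are second derivatives of the cubic. For a sum of two cubes they
  -- all lie in the span of two linear forms, so the determinant vanishes.
  refine notMem_zariskiClosure (!![C 3 * X 0, X 5, X 9; X 3, C 3 * X 1, C 2 * X 6;
    X 4, X 6, C 2 * X 8].det) (fun l => ?_) ?_
  · simp [Matrix.det_fin_three, cubeCoeff]
    ring
  · simpa [Matrix.det_fin_three] using hc

/-- The minor of the catalecticant matrix with columns `xy, y², yz` obstructs border rank two. -/
theorem ternaryCubic_notMem_zariskiClosure_two' {c : Fin 10 → ℂ}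
    (hc : !![2 * c 3, c 5, c 9; 2 * c 5, 3 * c 1, 2 * c 6; c 9, c 6, 2 * c 8].det ≠ 0) :
    ternaryCubic c ∉ zariskiClosure 3 3 (powerSums 3 3 2) := by
  refine notMem_zariskiClosure (!![C 2 * X 3, X 5, X 9; C 2 * X 5, C 3 * X 1, C 2 * X 6;
    X 9, X 6, C 2 * X 8].det) (fun l => ?_) ?_
  · simp [Matrix.det_fin_three, cubeCoeff]
    ring
  · simpa [Matrix.det_fin_three] using hc

/-- The Aronhold invariant of the ternary cubic
`a x³ + b y³ + c z³ + 3a₂ x²y + 3a₃ x²z + 3b₁ xy² + 3b₃ y²z + 3c₁ xz² + 3c₂ yz² + 6m xyz`. -/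
def aronhold {R : Type*} [CommRing R] (a b c a₂ a₃ b₁ b₃ c₁ c₂ m : R) : R :=
  a * b * c * m - (b * c * a₂ * a₃ + c * a * b₁ * b₃ + a * b * c₁ * c₂)
    - m * (a * b₃ * c₂ + b * c₁ * a₃ + c * a₂ * b₁)
    + (a * b₁ * c₂ ^ 2 + a * c₁ * b₃ ^ 2 + b * a₂ * c₁ ^ 2 + b * c₂ * a₃ ^ 2 + c * b₃ * a₂ ^ 2
      + c * a₃ * b₁ ^ 2)
    - m ^ 4 + 2 * m ^ 2 * (b₁ * c₁ + c₂ * a₂ + a₃ * b₃)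
    - 3 * m * (a₂ * b₃ * c₁ + a₃ * b₁ * c₂)
    - (b₁ ^ 2 * c₁ ^ 2 + c₂ ^ 2 * a₂ ^ 2 + a₃ ^ 2 * b₃ ^ 2)
    + (c₂ * a₂ * a₃ * b₃ + a₃ * b₃ * b₁ * c₁ + b₁ * c₁ * c₂ * a₂)

/-- Allowing any commutative ring lets the same expression serve as a polynomial in the coefficients
and, after evaluation, as its value. -/
theorem map_aronhold {R S : Type*} [CommRing R] [CommRing S] (f : R →+* S)
    (a b c a₂ a₃ b₁ b₃ c₁ c₂ m : R) :
    f (aronhold a b c a₂ a₃ b₁ b₃ c₁ c₂ m) =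
      aronhold (f a) (f b) (f c) (f a₂) (f a₃) (f b₁) (f b₃) (f c₁) (f c₂) (f m) := by
  simp [aronhold, map_ofNat]

/-- The Aronhold invariant vanishes on sums of three cubes of linear forms. -/
theorem aronhold_sum_three_cubes {R : Type*} [CommRing R] (x y z x' y' z' x'' y'' z'' : R) :
    aronhold (x ^ 3 + x' ^ 3 + x'' ^ 3) (y ^ 3 + y' ^ 3 + y'' ^ 3) (z ^ 3 + z' ^ 3 + z'' ^ 3)
      (x ^ 2 * y + x' ^ 2 * y' + x'' ^ 2 * y'') (x ^ 2 * z + x' ^ 2 * z' + x'' ^ 2 * z'')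
      (x * y ^ 2 + x' * y' ^ 2 + x'' * y'' ^ 2) (y ^ 2 * z + y' ^ 2 * z' + y'' ^ 2 * z'')
      (x * z ^ 2 + x' * z' ^ 2 + x'' * z'' ^ 2) (y * z ^ 2 + y' * z' ^ 2 + y'' * z'' ^ 2)
      (x * y * z + x' * y' * z' + x'' * y'' * z'') = 0 := by
  unfold aronhold
  ring

theorem ternaryCubic_notMem_zariskiClosure_three {c : Fin 10 → ℂ}
    (hc : aronhold (c 0) (c 1) (c 2) (c 3 / 3) (c 4 / 3) (c 5 / 3) (c 6 / 3) (c 7 / 3) (c 8 / 3)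
      (c 9 / 6) ≠ 0) :
    ternaryCubic c ∉ zariskiClosure 3 3 (powerSums 3 3 3) := by
  -- Dividing by 3 and 6 removes the multinomial coefficients, as the normalization of `aronhold`
  -- requires.
  refine notMem_zariskiClosure (aronhold (X 0) (X 1) (X 2) (X 3 * C 3⁻¹) (X 4 * C 3⁻¹)
    (X 5 * C 3⁻¹) (X 6 * C 3⁻¹) (X 7 * C 3⁻¹) (X 8 * C 3⁻¹) (X 9 * C 6⁻¹)) (fun l => ?_) ?_
  · rw [map_aronhold, ← aronhold_sum_three_cubes (l 0 0) (l 0 1) (l 0 2) (l 1 0) (l 1 1) (l 1 2)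
      (l 2 0) (l 2 1) (l 2 2)]
    simp only [map_mul, eval_X, eval_C, Fin.sum_univ_three, cubeCoeff]
    congr 1 <;> simp <;> ring
  · simpa [map_aronhold, div_eq_mul_inv] using hc

/-! ### Rank and border rank of the normal forms -/

/-- The plane cubic `y²z - x³ - axz² - bz³`. -/
def weierstrass (a b : ℂ) : MvPolynomial (Fin 3) ℂ :=
  ternaryCubic ![-1, 0, -b, 0, 0, 0, 1, -a, 0, 0]

theorem ranks_tripleLine :
    waringRank 3 (ternaryCubic ![1, 0, 0, 0, 0, 0, 0, 0, 0, 0]) = 1 ∧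
      borderRank 3 (ternaryCubic ![1, 0, 0, 0, 0, 0, 0, 0, 0, 0]) = 1 := by
  refine rank_and_borderRank_eq_succ (mem_powerSums_of_eval ![1] ![![1, 0, 0]] fun x y z => ?_)
    (ternaryCubic_notMem_zariskiClosure_zero (by simp))
  simp [eval_ternaryCubic]

theorem ranks_threeConcurrentLines :
    waringRank 3 (ternaryCubic ![0, 0, 0, 1, 0, 1, 0, 0, 0, 0]) = 2 ∧
      borderRank 3 (ternaryCubic ![0, 0, 0, 1, 0, 1, 0, 0, 0, 0]) = 2 := by
  obtain ⟨w, hw⟩ : ∃ w : ℂ, w ^ 2 = -3 := IsAlgClosed.exists_pow_nat_eq _ (by norm_num)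
  -- The numbers (1 ± w)/2 are the primitive sixth roots of unity. Both have cube −1, so y³ cancels
  -- in the difference of the two cubes.
  have hw' : w * w⁻¹ = 1 := mul_inv_cancel₀ (by rintro rfl; norm_num at hw)
  refine rank_and_borderRank_eq_succ (mem_powerSums_of_eval ![w⁻¹ / 3, -w⁻¹ / 3]
    ![![1, (1 + w) / 2, 0], ![1, (1 - w) / 2, 0]] fun x y z => ?_)
    (ternaryCubic_notMem_zariskiClosure_one (by simp))
  simp [eval_ternaryCubic]
  linear_combination -(x ^ 2 * y + x * y ^ 2) * hw' - y ^ 3 * w⁻¹ * w / 12 * hw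

theorem mem_powerSums_x2y : ternaryCubic ![0, 0, 0, 1, 0, 0, 0, 0, 0, 0] ∈ powerSums 3 3 3 := by
  refine mem_powerSums_of_eval ![1 / 6, -1 / 6, -1 / 3] ![![1, 1, 0], ![1, -1, 0], ![0, 1, 0]]
    fun x y z => ?_
  simp [eval_ternaryCubic, Fin.sum_univ_succ]
  ring

theorem ranks_doubleLinePlusLine :
    waringRank 3 (ternaryCubic ![0, 0, 0, 1, 0, 0, 0, 0, 0, 0]) = 3 ∧
      borderRank 3 (ternaryCubic ![0, 0, 0, 1, 0, 0, 0, 0, 0, 0]) = 2 := by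
  constructor
  · refine waringRank_eq_succ mem_powerSums_x2y fun h => ?_
    obtain ⟨l, hl⟩ := coeff_of_mem_powerSums h
    have h0 := hl 0
    have h1 := hl 1
    have h3 := hl 3
    have h5 := hl 5
    simp [cubeCoeff] at h0 h1 h3 h5
    -- For a sum of two cubes, c₃² − 3c₀c₅ equals −9 times `l 0 0 * l 1 0` times the square of this
    -- determinant. For x²y it equals 1.
    have hdet : l 0 0 * l 1 1 - l 0 1 * l 1 0 ≠ 0 := by
      intro hdet
      have : (1 : ℂ) = 0 := by
        linear_combination (1 + 3 * (l 0 0 ^ 2 * l 0 1 + l 1 0 ^ 2 * l 1 1)) * h3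
          - 9 * (l 0 0 * l 0 1 ^ 2 + l 1 0 * l 1 1 ^ 2) * h0
          - 9 * l 0 0 * l 1 0 * (l 0 0 * l 1 1 - l 0 1 * l 1 0) * hdet
      exact one_ne_zero this
    -- The coefficients of y³ and xy² vanish, so the squares of the y-coordinates are the
    -- coefficients of a linear relation between two independent vectors. Hence both squares are 0.
    have hb : l 0 1 ^ 2 * (l 0 0 * l 1 1 - l 0 1 * l 1 0) = 0 := by
      linear_combination l 1 0 * h1 - l 1 1 / 3 * h5
    have he : l 1 1 ^ 2 * (l 0 0 * l 1 1 - l 0 1 * l 1 0) = 0 := by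
      linear_combination l 0 1 / 3 * h5 - l 0 0 * h1
    have hb' : l 0 1 = 0 := by simpa [hdet] using hb
    have he' : l 1 1 = 0 := by simpa [hdet] using he
    simp [hb', he'] at h3
  · refine borderRank_eq_succ ?_ (ternaryCubic_notMem_zariskiClosure_one (by simp))
    -- The family is the difference quotient ((x + ty)³ − x³)/(3t), with limit x²y.
    have := mem_zariskiClosure_of_family (r := 2)
      (fun t => ![0, t ^ 2 / 3, 0, 1, 0, t, 0, 0, 0, 0])
      (by intro i; fin_cases i <;> simp <;> fun_prop) fun t ht => ?_
    · simpa using this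
    · refine mem_powerSums_of_eval ![t⁻¹ / 3, -t⁻¹ / 3] ![![1, t, 0], ![1, 0, 0]] fun x y z => ?_
      simp [eval_ternaryCubic, Fin.sum_univ_succ]
      field_simp
      ring

theorem ranks_fermat :
    waringRank 3 (weierstrass 0 1) = 3 ∧ borderRank 3 (weierstrass 0 1) = 3 := by
  obtain ⟨w, hw⟩ : ∃ w : ℂ, w ^ 2 = -3 := IsAlgClosed.exists_pow_nat_eq _ (by norm_num)
  refine rank_and_borderRank_eq_succ (mem_powerSums_of_eval ![-1, -1 / 2, -1 / 2]
    ![![1, 0, 0], ![0, w / 3, 1], ![0, -w / 3, 1]] fun x y z => ?_)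
    (ternaryCubic_notMem_zariskiClosure_two (by simp [Matrix.det_fin_three]))
  simp [weierstrass, eval_ternaryCubic, Fin.sum_univ_succ]
  linear_combination y ^ 2 * z / 3 * hw

/-- Split the form as (y²z + (s − b)z³) − (x³ + axz² + sz³). The first bracket is a sum of two cubes
of ±cy + z when 3(s − b)c² = 1. The second is a combination of the cubes of x + pz and x + qz when
3pq = −a and s = a(p + q)/3. What remains is to choose p with q ≠ p and s ≠ b. -/
theorem weierstrass_mem_powerSums {a b : ℂ} (ha : a ≠ 0) : weierstrass a b ∈ powerSums 3 3 4 := by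
  -- The second factor vanishes exactly when q = p, and the third equals 9p(s − b). Neither is the
  -- zero polynomial because a ≠ 0, so a generic p works.
  obtain ⟨p, hp⟩ : ∃ p : ℂ, p * (3 * p ^ 2 + a) * (3 * a * p ^ 2 - 9 * b * p - a ^ 2) ≠ 0 := by
    by_contra! h
    have h0 : (Polynomial.X * (3 * Polynomial.X ^ 2 + Polynomial.C a) *
        (3 * Polynomial.C a * Polynomial.X ^ 2 - 9 * Polynomial.C b * Polynomial.X -
          Polynomial.C (a ^ 2)) : Polynomial ℂ) = 0 :=
      Polynomial.funext fun p => by simpa using h p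
    rcases mul_eq_zero.1 h0 with h1 | h1
    · rcases mul_eq_zero.1 h1 with h2 | h2
      · exact Polynomial.X_ne_zero h2
      · exact ha (by simpa using congrArg (Polynomial.eval 0) h2)
    · exact ha (by simpa using congrArg (Polynomial.eval 0) h1)
  have hp0 : p ≠ 0 := by rintro rfl; simp at hp
  have hpa : 3 * p ^ 2 + a ≠ 0 := fun h => hp (by rw [h]; ring)
  have hpb : 3 * a * p ^ 2 - 9 * b * p - a ^ 2 ≠ 0 := fun h => hp (by rw [h]; ring)
  obtain ⟨q, hq⟩ : ∃ q : ℂ, 3 * (p * q) = -a := ⟨-a / (3 * p), by field_simp⟩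
  have hqp : q - p ≠ 0 := fun h => hpa (by linear_combination hq - 3 * p * h)
  obtain ⟨s, hs⟩ : ∃ s, s = a / 3 * (p + q) := ⟨_, rfl⟩
  have hsb : s - b ≠ 0 := fun h => hpb (by linear_combination 9 * p * h - a * hq - 9 * p * hs)
  obtain ⟨c, hc⟩ : ∃ c : ℂ, c ^ 2 = (3 * (s - b))⁻¹ := IsAlgClosed.exists_pow_nat_eq _ (by norm_num)
  have hc' : 3 * (s - b) * c ^ 2 = 1 := by rw [hc]; field_simp
  obtain ⟨i, hi⟩ : ∃ i : ℂ, i * (q - p) = 1 := ⟨(q - p)⁻¹, inv_mul_cancel₀ hqp⟩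
  refine mem_powerSums_of_eval ![(s - b) / 2, (s - b) / 2, -(q * i), p * i]
    ![![0, c, 1], ![0, -c, 1], ![1, 0, p], ![1, 0, q]] fun x y z => ?_
  simp [weierstrass, eval_ternaryCubic, Fin.sum_univ_succ]
  linear_combination -(y ^ 2 * z) * hc'
    - (-x ^ 3 + 3 * p * q * x * z ^ 2 + p * q * (p + q) * z ^ 3) * hi
    - (x * z ^ 2 + (p + q) / 3 * z ^ 3) * hq - z ^ 3 * hs

/-- The Aronhold invariant of this form is a/27, whatever b is. -/
theorem aronhold_weierstrass {a b : ℂ} (ha : a ≠ 0) :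
    weierstrass a b ∉ zariskiClosure 3 3 (powerSums 3 3 3) :=
  ternaryCubic_notMem_zariskiClosure_three (by simp [aronhold, ha])

theorem ranks_weierstrass {a b : ℂ} (ha : a ≠ 0) :
    waringRank 3 (weierstrass a b) = 4 ∧ borderRank 3 (weierstrass a b) = 4 :=
  rank_and_borderRank_eq_succ (weierstrass_mem_powerSums ha) (aronhold_weierstrass ha)

theorem ranks_triangle :
    waringRank 3 (ternaryCubic ![0, 0, 0, 0, 0, 0, 0, 0, 0, 1]) = 4 ∧
      borderRank 3 (ternaryCubic ![0, 0, 0, 0, 0, 0, 0, 0, 0, 1]) = 4 := by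
  refine rank_and_borderRank_eq_succ (mem_powerSums_of_eval ![1 / 24, -1 / 24, -1 / 24, -1 / 24]
    ![![1, 1, 1], ![-1, 1, 1], ![1, -1, 1], ![1, 1, -1]] fun x y z => ?_)
    (ternaryCubic_notMem_zariskiClosure_three (by simp [aronhold]))
  simp [eval_ternaryCubic, Fin.sum_univ_succ]
  ring

theorem ranks_conicPlusTransversalLine :
    waringRank 3 (ternaryCubic ![1, 0, 0, 0, 0, 0, 0, 0, 0, 1]) = 4 ∧
      borderRank 3 (ternaryCubic ![1, 0, 0, 0, 0, 0, 0, 0, 0, 1]) = 4 := by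
  -- Since 4yz = (y + z)² − (y − z)², two pairs of cubes (x ± u)³, with u proportional to y + z and
  -- to y − z, suffice: each pair sums to 2x³ + 6xu².
  refine rank_and_borderRank_eq_succ (mem_powerSums_of_eval ![2 / 3, 2 / 3, -1 / 6, -1 / 6]
    ![![1, 1 / 4, 1 / 4], ![1, -1 / 4, -1 / 4], ![1, 1 / 2, -1 / 2], ![1, -1 / 2, 1 / 2]]
    fun x y z => ?_)
    (ternaryCubic_notMem_zariskiClosure_three (by simp [aronhold]))
  simp [eval_ternaryCubic, Fin.sum_univ_succ]
  ring

/-- A ternary cubic of rank at most `r` with independent partial derivatives is a sum of cubes of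
`r` linear forms without a common zero. -/
theorem injective_mulVec_of_cubes {r : ℕ} {c : Fin 10 → ℂ} {l : Fin r → Fin 3 → ℂ}
    (hl : ∀ i, c i = ∑ k, cubeCoeff (l k) i)
    (hc : ∀ u v w : ℂ, 3 * c 0 * u + c 3 * v + c 4 * w = 0 → c 5 * u + 3 * c 1 * v + c 6 * w = 0 →
      2 * c 3 * u + 2 * c 5 * v + c 9 * w = 0 → c 9 * u + 2 * c 6 * v + 2 * c 8 * w = 0 →
      u = 0 ∧ v = 0 ∧ w = 0)
    (u v w : ℂ) (h : ∀ k, l k 0 * u + l k 1 * v + l k 2 * w = 0) : u = 0 ∧ v = 0 ∧ w = 0 := by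
  -- The derivative in direction (u, v, w) kills every lₖ, hence the cubic. The hypotheses of `hc`
  -- are the vanishing of the x², y², xy and yz coefficients of that derivative.
  apply hc
  all_goals
    simp only [hl, Finset.mul_sum, Finset.sum_mul, ← Finset.sum_add_distrib]
    refine Finset.sum_eq_zero fun k _ => ?_
    simp only [cubeCoeff, Matrix.cons_val]
  · linear_combination 3 * l k 0 ^ 2 * h k
  · linear_combination 3 * l k 1 ^ 2 * h k
  · linear_combination 6 * l k 0 * l k 1 * h k
  · linear_combination 6 * l k 1 * l k 2 * h k

theorem ranks_cusp :
    waringRank 3 (weierstrass 0 0) = 4 ∧ borderRank 3 (weierstrass 0 0) = 3 := by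
  constructor
  · refine waringRank_eq_succ (mem_powerSums_of_eval ![-1, 1 / 6, 1 / 6, -1 / 3]
      ![![1, 0, 0], ![0, 1, 1], ![0, -1, 1], ![0, 0, 1]] fun x y z => ?_) fun h => ?_
    · simp [weierstrass, eval_ternaryCubic, Fin.sum_univ_succ]
      ring
    · obtain ⟨l, hl⟩ := coeff_of_mem_powerSums h
      simp only [weierstrass, coeff_cubicMonomial] at hl
      have hinj := injective_mulVec_of_cubes hl (by simp +contextual)
      have hdet : (Matrix.of l).det ≠ 0 := by
        intro h0
        obtain ⟨v, hv, hv0⟩ := Matrix.exists_mulVec_eq_zero_iff.2 h0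
        refine hv (funext fun i => ?_)
        have := hinj (v 0) (v 1) (v 2) fun k => by
          simpa [Matrix.mulVec, dotProduct, Fin.sum_univ_three] using congrFun hv0 k
        fin_cases i
        exacts [this.1, this.2.1, this.2.2]
      -- As ∂z² annihilates the cubic, the squares of the z-coordinates are the coefficients of a
      -- linear relation among three independent forms.
      have hw : (fun k => l k 2 ^ 2) = 0 := by
        refine Matrix.eq_zero_of_vecMul_eq_zero hdet (funext fun i => ?_)
        have h2 := hl 2
        have h7 := hl 7
        have h8 := hl 8
        simp [cubeCoeff, Fin.sum_univ_three] at h2 h7 h8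
        fin_cases i <;> simp [Matrix.vecMul, dotProduct, Fin.sum_univ_three]
        · linear_combination -h7 / 3
        · linear_combination -h8 / 3
        · linear_combination -h2
      have := hinj 0 0 1 fun k => by simpa using congrFun hw k
      simp at this
  · refine borderRank_eq_succ ?_ (ternaryCubic_notMem_zariskiClosure_two
      (by simp [Matrix.det_fin_three]))
    -- The family is −x³ + ((y + tz)³ − y³)/(3t).
    have := mem_zariskiClosure_of_family (r := 3)
      (fun t => ![-1, 0, t ^ 2 / 3, 0, 0, 0, 1, 0, t, 0])
      (by intro i; fin_cases i <;> simp <;> fun_prop) fun t ht => ?_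
    · simpa [weierstrass] using this
    · refine mem_powerSums_of_eval ![-1, t⁻¹ / 3, -t⁻¹ / 3] ![![1, 0, 0], ![0, 1, t], ![0, 1, 0]]
        fun x y z => ?_
      simp [eval_ternaryCubic, Fin.sum_univ_succ]
      field_simp
      ring

/-- If four vectors span `ℂ³`, then their linear relations are multiples of a single one. -/
theorem exists_relation_of_four {l : Fin 4 → Fin 3 → ℂ}
    (hl : ∀ u v w : ℂ, (∀ k, l k 0 * u + l k 1 * v + l k 2 * w = 0) → u = 0 ∧ v = 0 ∧ w = 0) :
    ∃ e : Fin 4 → ℂ, ∀ f : Fin 4 → ℂ, (∀ i, ∑ k, f k * l k i = 0) → ∃ c : ℂ, ∀ k, f k = c * e k := by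
  have hker : LinearMap.ker (Matrix.of l).mulVecLin = ⊥ := by
    refine LinearMap.ker_eq_bot'.2 fun v hv => funext fun i => ?_
    have := hl (v 0) (v 1) (v 2) fun k => by
      simpa [Matrix.mulVec, dotProduct, Fin.sum_univ_three] using congrFun hv k
    fin_cases i
    exacts [this.1, this.2.1, this.2.2]
  have hrank : (Matrix.of l).transpose.rank = 3 := by
    have := LinearMap.finrank_range_add_finrank_ker (Matrix.of l).mulVecLin
    rw [hker, finrank_bot] at this
    rw [Matrix.rank_transpose]
    simpa [Matrix.rank] using this
  have hone : Module.finrank ℂ (LinearMap.ker (Matrix.of l).transpose.mulVecLin) = 1 := by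
    have := LinearMap.finrank_range_add_finrank_ker (Matrix.of l).transpose.mulVecLin
    rw [← Matrix.rank, hrank, Module.finrank_fin_fun] at this
    omega
  obtain ⟨e, -, he⟩ := finrank_eq_one_iff'.1 hone
  refine ⟨e, fun f hf => ?_⟩
  obtain ⟨c, hc⟩ := he ⟨f, by
    refine LinearMap.mem_ker.2 (funext fun i => ?_)
    simpa [Matrix.vecMul, dotProduct] using hf i⟩
  exact ⟨c, fun k => (congrFun (congrArg Subtype.val hc) k).symm⟩

/-- The operators ∂z², ∂x∂z and ∂x² − ∂y∂z annihilate the form. Each gives a linear relation among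
the four forms, with its values at the lₖ as coefficients, and these relations are all multiples of
a single e. Writing zₖ² = αeₖ and xₖzₖ = βeₖ, every lₖ then satisfies αx = βz with α ≠ 0, although
the lₖ span the space. -/
theorem conicPlusTangentLine_notMem_powerSums_four :
    ternaryCubic ![0, 0, 0, 1, 0, 0, 1, 0, 0, 0] ∉ powerSums 3 3 4 := by
  intro h
  obtain ⟨l, hl⟩ := coeff_of_mem_powerSums h
  simp only [coeff_cubicMonomial] at hl
  have hinj := injective_mulVec_of_cubes hl (by simp +contextual)
  obtain ⟨e, he⟩ := exists_relation_of_four hinj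
  have h0 := hl 0
  have h2 := hl 2
  have h3 := hl 3
  have h4 := hl 4
  have h6 := hl 6
  have h7 := hl 7
  have h8 := hl 8
  have h9 := hl 9
  simp [cubeCoeff, Fin.sum_univ_four] at h0 h2 h3 h4 h6 h7 h8 h9
  obtain ⟨α, hα⟩ := he (fun k => l k 2 ^ 2) (by
    intro i
    fin_cases i <;> simp [Fin.sum_univ_four]
    · linear_combination -h7 / 3
    · linear_combination -h8 / 3
    · linear_combination -h2)
  obtain ⟨β, hβ⟩ := he (fun k => l k 0 * l k 2) (by
    intro i
    fin_cases i <;> simp [Fin.sum_univ_four]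
    · linear_combination -h4 / 3
    · linear_combination -h9 / 6
    · linear_combination -h7 / 3)
  obtain ⟨γ, hγ⟩ := he (fun k => l k 0 ^ 2 - l k 1 * l k 2) (by
    intro i
    fin_cases i <;> simp [Fin.sum_univ_four]
    · linear_combination -h0 + h9 / 6
    · linear_combination -h3 / 3 + h6 / 3
    · linear_combination -h4 / 3 + h8 / 3)
  have hα0 : α ≠ 0 := by
    rintro rfl
    have := hinj 0 0 1 fun k => by simpa using hα k
    simp at this
  have := hinj α 0 (-β) fun k => by
    have hk : l k 2 * (l k 0 * α - l k 2 * β) = 0 := by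
      linear_combination α * hβ k - β * hα k
    -- If zₖ = 0, then eₖ = 0, and the third operator gives xₖ² = 0.
    rcases mul_eq_zero.1 hk with hz | hz
    · have hek : e k = 0 := by
        have := hα k
        simp only [hz] at this
        simpa [hα0] using this.symm
      have hx : l k 0 = 0 := by simpa [hz, hek] using hγ k
      rw [hx, hz]
      ring
    · linear_combination hz
  exact hα0 this.1

theorem ranks_conicPlusTangentLine :
    waringRank 3 (ternaryCubic ![0, 0, 0, 1, 0, 0, 1, 0, 0, 0]) = 5 ∧
      borderRank 3 (ternaryCubic ![0, 0, 0, 1, 0, 0, 1, 0, 0, 0]) = 3 := by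
  constructor
  -- The first two cubes give x²y + y³/3. The other three are the second difference (u + y)³ + (u −
  -- y)³ − 2u³ with u = z − y/3, which gives y²z − y³/3.
  · refine waringRank_eq_succ (mem_powerSums_of_eval ![1 / 6, 1 / 6, 1 / 6, 1 / 6, -1 / 3]
      ![![1, 1, 0], ![-1, 1, 0], ![0, 2 / 3, 1], ![0, -4 / 3, 1], ![0, -1 / 3, 1]]
      fun x y z => ?_) conicPlusTangentLine_notMem_powerSums_four
    simp [eval_ternaryCubic, Fin.sum_univ_succ]
    ring
  · refine borderRank_eq_succ ?_ (ternaryCubic_notMem_zariskiClosure_two'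
      (by simp [Matrix.det_fin_three]))
    -- A second difference quotient along a conic: the points (±t, 1, t²) tend to (0, 1, 0).
    have := mem_zariskiClosure_of_family (r := 3)
      (fun t => ![0, 0, t ^ 4 / 3, 1, t ^ 2, 0, 1, 0, t ^ 2, 0])
      (by intro i; fin_cases i <;> simp <;> fun_prop) fun t ht => ?_
    · simpa using this
    · refine mem_powerSums_of_eval ![(t ^ 2)⁻¹ / 6, (t ^ 2)⁻¹ / 6, -(t ^ 2)⁻¹ / 3]
        ![![t, 1, t ^ 2], ![-t, 1, t ^ 2], ![0, 1, 0]] fun x y z => ?_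
      simp [eval_ternaryCubic, Fin.sum_univ_succ]
      field_simp
      ring

/-! ### Irreducible forms of degree at most three -/

theorem eq_C_add_linearForm {n : ℕ} {G : MvPolynomial (Fin n) ℂ} (hG : G.totalDegree ≤ 1) :
    G = C (coeff 0 G) + linearForm fun i => coeff (Finsupp.single i 1) G := by
  classical
  ext m
  simp only [linearForm, coeff_add, coeff_C, coeff_sum, coeff_C_mul, coeff_X]
  rcases Nat.lt_or_ge 1 m.degree with hm | hm
  · have h0 : (0 : Fin n →₀ ℕ) ≠ m := by
      rintro rfl
      simp at hm
    have h1 (i : Fin n) : Finsupp.single i 1 ≠ m := by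
      rintro rfl
      simp at hm
    rw [coeff_eq_zero_of_totalDegree_lt (lt_of_le_of_lt hG hm)]
    simp [h0, h1]
  · by_cases h0 : m = 0
    · subst h0
      simp
    · have h1 : m.degree = 1 := le_antisymm hm
        (Nat.one_le_iff_ne_zero.2 fun h => h0 ((Finsupp.degree_eq_zero_iff m).1 h))
      obtain ⟨i, rfl⟩ : ∃ i, m = Finsupp.single i 1 := by
        have h2 : m ∈ {d : Fin n →₀ ℕ | d.degree = 1} := h1
        rw [← Finsupp.range_single_one] at h2
        obtain ⟨i, hi⟩ := h2
        exact ⟨i, hi.symm⟩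
      simp [Finsupp.single_left_inj, Ne.symm h0]

theorem eval_smul_of_isHomogeneous {n d : ℕ} {F : MvPolynomial (Fin n) ℂ} (hF : F.IsHomogeneous d)
    (t : ℂ) (p : Fin n → ℂ) : eval (t • p) F = t ^ d * eval p F := by
  rw [eval_eq, eval_eq, Finset.mul_sum]
  refine Finset.sum_congr rfl fun m hm => ?_
  have hd : ∑ i ∈ m.support, m i = d := hF.degree_eq_sum_deg_support hm |>.symm
  simp only [Pi.smul_apply, smul_eq_mul, mul_pow, Finset.prod_mul_distrib, Finset.prod_pow_eq_pow_sum,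
    hd]
  ring

/-- A nonzero form of degree two or three that contains no hyperplane is irreducible. -/
theorem irreducible_of_forall_linear {n d : ℕ} {F : MvPolynomial (Fin n) ℂ}
    (hF : F.IsHomogeneous d) (hd : 2 ≤ d) (hd' : d ≤ 3) (hF0 : F ≠ 0)
    (h : ∀ l : Fin n → ℂ, (∀ p : Fin n → ℂ, ∑ i, l i * p i = 0 → eval p F = 0) → l = 0) :
    Irreducible F := by
  -- In a factorization of a form of degree at most 3, one factor has degree at most 1. It therefore
  -- suffices that every such divisor is a unit.
  have key (G : MvPolynomial (Fin n) ℂ) (hGF : G ∣ F) (hG : G.totalDegree ≤ 1) : IsUnit G := by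
    obtain ⟨H, rfl⟩ := hGF
    have hG' := eq_C_add_linearForm hG
    set c := coeff 0 G
    set l : Fin n → ℂ := fun i => coeff (Finsupp.single i 1) G
    have hl : l = 0 := by
      by_contra hl
      have hlf : linearForm l ≠ 0 := by
        intro h0
        refine hl (funext fun i => ?_)
        have := eval_linearForm l (Pi.single i 1)
        simpa [h0, Pi.single_apply] using this.symm
      have hvan (p : Fin n → ℂ) (hp : c + ∑ i, l i * p i = 0) : eval p (G * H) = 0 := by
        rw [map_mul, hG', map_add, eval_C, eval_linearForm, hp, zero_mul]
      have hc : c ≠ 0 := fun hc => hl (h l fun p hp => hvan p (by rw [hc, hp, add_zero]))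
      -- The form vanishes on the affine hyperplane c + l = 0. By homogeneity it vanishes wherever l
      -- ≠ 0, so its product with l is zero.
      refine mul_ne_zero hlf hF0 (MvPolynomial.funext fun p => ?_)
      rw [map_mul, eval_linearForm, map_zero]
      by_cases hp : ∑ i, l i * p i = 0
      · rw [hp, zero_mul]
      · have h1 : eval ((-c / ∑ i, l i * p i) • p) (G * H) = 0 := by
          refine hvan _ ?_
          have hs : ∀ i, l i * ((-c / ∑ i, l i * p i) • p) i = -c / (∑ i, l i * p i) * (l i * p i) :=
            fun i => by rw [Pi.smul_apply, smul_eq_mul, mul_left_comm]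
          rw [Finset.sum_congr rfl fun i _ => hs i, ← Finset.mul_sum, div_mul_cancel₀ _ hp,
            add_neg_cancel]
        rw [eval_smul_of_isHomogeneous hF] at h1
        rw [(mul_eq_zero.1 h1).resolve_left (pow_ne_zero _ (div_ne_zero (neg_ne_zero.2 hc) hp)),
          mul_zero]
    have hGC : G = C c := by
      rw [hG', hl]
      simp [linearForm]
    rw [hGC]
    refine (isUnit_iff_ne_zero.2 fun hc => hF0 ?_).map C
    rw [hGC, hc, C_0, zero_mul]
  refine ⟨fun hu => ?_, fun G H hGH => ?_⟩
  · have := (isUnit_iff_totalDegree_of_isReduced.1 hu).2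
    rw [hF.totalDegree hF0] at this
    omega
  · have hG : G ≠ 0 := by rintro rfl; simp [hF0] at hGH
    have hH : H ≠ 0 := by rintro rfl; simp [hF0] at hGH
    have hdeg := totalDegree_mul_of_isDomain hG hH
    rw [← hGH, hF.totalDegree hF0] at hdeg
    rcases Nat.lt_or_ge 1 G.totalDegree with h1 | h1
    · exact Or.inr (key H ⟨G, by rw [hGH, mul_comm]⟩ (by omega))
    · exact Or.inl (key G ⟨H, hGH⟩ h1)

/-! ### Derivatives of ternary cubics -/

theorem ternaryCubic_eq (c : Fin 10 → ℂ) : ternaryCubic c = C (c 0) * X 0 ^ 3 + C (c 1) * X 1 ^ 3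
      + C (c 2) * X 2 ^ 3 + C (c 3) * X 0 ^ 2 * X 1 + C (c 4) * X 0 ^ 2 * X 2
      + C (c 5) * X 0 * X 1 ^ 2 + C (c 6) * X 1 ^ 2 * X 2 + C (c 7) * X 0 * X 2 ^ 2
      + C (c 8) * X 1 * X 2 ^ 2 + C (c 9) * X 0 * X 1 * X 2 :=
  MvPolynomial.funext fun p => by
    rw [eval_ternaryCubic]
    simp

theorem pderiv_zero_ternaryCubic (c : Fin 10 → ℂ) : pderiv 0 (ternaryCubic c) =
    C (3 * c 0) * X 0 ^ 2 + C (2 * c 3) * X 0 * X 1 + C (2 * c 4) * X 0 * X 2 + C (c 5) * X 1 ^ 2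
      + C (c 7) * X 2 ^ 2 + C (c 9) * X 1 * X 2 :=
  MvPolynomial.funext fun p => by
    rw [ternaryCubic_eq]
    simp [pderiv_X]
    ring

theorem pderiv_one_ternaryCubic (c : Fin 10 → ℂ) : pderiv 1 (ternaryCubic c) =
    C (3 * c 1) * X 1 ^ 2 + C (c 3) * X 0 ^ 2 + C (2 * c 5) * X 0 * X 1 + C (2 * c 6) * X 1 * X 2
      + C (c 8) * X 2 ^ 2 + C (c 9) * X 0 * X 2 :=
  MvPolynomial.funext fun p => by
    rw [ternaryCubic_eq]
    simp [pderiv_X]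
    ring

theorem pderiv_two_ternaryCubic (c : Fin 10 → ℂ) : pderiv 2 (ternaryCubic c) =
    C (3 * c 2) * X 2 ^ 2 + C (c 4) * X 0 ^ 2 + C (c 6) * X 1 ^ 2 + C (2 * c 7) * X 0 * X 2
      + C (2 * c 8) * X 1 * X 2 + C (c 9) * X 0 * X 1 :=
  MvPolynomial.funext fun p => by
    rw [ternaryCubic_eq]
    simp [pderiv_X]
    ring

theorem hessianAt_ternaryCubic (c : Fin 10 → ℂ) (p : Fin 3 → ℂ) :
    hessianAt (ternaryCubic c) p =
      !![6 * c 0 * p 0 + 2 * c 3 * p 1 + 2 * c 4 * p 2, 2 * c 3 * p 0 + 2 * c 5 * p 1 + c 9 * p 2,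
          2 * c 4 * p 0 + c 9 * p 1 + 2 * c 7 * p 2;
        2 * c 3 * p 0 + 2 * c 5 * p 1 + c 9 * p 2, 2 * c 5 * p 0 + 6 * c 1 * p 1 + 2 * c 6 * p 2,
          c 9 * p 0 + 2 * c 6 * p 1 + 2 * c 8 * p 2;
        2 * c 4 * p 0 + c 9 * p 1 + 2 * c 7 * p 2, c 9 * p 0 + 2 * c 6 * p 1 + 2 * c 8 * p 2,
          2 * c 7 * p 0 + 2 * c 8 * p 1 + 6 * c 2 * p 2] := by
  ext i j
  fin_cases i <;> fin_cases j <;>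
    simp [hessianAt, pderiv_zero_ternaryCubic, pderiv_one_ternaryCubic, pderiv_two_ternaryCubic,
      pderiv_X] <;> ring

theorem mem_rightKernel_ternaryCubic {c : Fin 10 → ℂ} {Q : Matrix (Fin 3) (Fin 3) ℂ} :
    Q ∈ rightKernel (ternaryCubic c) ↔ (Q 1 0 = Q 0 1 ∧ Q 2 0 = Q 0 2 ∧ Q 2 1 = Q 1 2) ∧
      3 * c 0 * Q 0 0 + c 5 * Q 1 1 + c 7 * Q 2 2 + 2 * c 3 * Q 0 1 + 2 * c 4 * Q 0 2
        + c 9 * Q 1 2 = 0 ∧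
      c 3 * Q 0 0 + 3 * c 1 * Q 1 1 + c 8 * Q 2 2 + 2 * c 5 * Q 0 1 + c 9 * Q 0 2
        + 2 * c 6 * Q 1 2 = 0 ∧
      c 4 * Q 0 0 + c 6 * Q 1 1 + 3 * c 2 * Q 2 2 + c 9 * Q 0 1 + 2 * c 7 * Q 0 2
        + 2 * c 8 * Q 1 2 = 0 := by
  have h1 : Q ∈ rightKernel (ternaryCubic c) ↔ Q.transpose = Q ∧
      ∑ i, ∑ j, Q i j • pderiv i (pderiv j (ternaryCubic c)) = 0 := Iff.rfl
  have h2 : ∑ i, ∑ j, Q i j • pderiv i (pderiv j (ternaryCubic c)) = 0 ↔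
      ∀ p, ∑ i, ∑ j, Q i j * hessianAt (ternaryCubic c) p i j = 0 := by
    constructor
    · intro h p
      simpa [hessianAt] using congrArg (eval p) h
    · intro h
      refine MvPolynomial.funext fun p => ?_
      simpa [hessianAt] using h p
  have h3 : Q.transpose = Q ↔ Q 1 0 = Q 0 1 ∧ Q 2 0 = Q 0 2 ∧ Q 2 1 = Q 1 2 := by
    constructor
    · intro h
      exact ⟨congrFun₂ h 0 1, congrFun₂ h 0 2, congrFun₂ h 1 2⟩
    · rintro ⟨h, h', h''⟩
      ext i j
      fin_cases i <;> fin_cases j <;> simp [h, h', h'']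
  rw [h1, h2, h3]
  refine and_congr_right fun ⟨h, h', h''⟩ => ?_
  simp only [hessianAt_ternaryCubic, Fin.sum_univ_three, h, h', h'']
  constructor
  · intro H
    have e0 := H ![1, 0, 0]
    have e1 := H ![0, 1, 0]
    have e2 := H ![0, 0, 1]
    simp at e0 e1 e2
    exact ⟨by linear_combination e0 / 2, by linear_combination e1 / 2, by linear_combination e2 / 2⟩
  · rintro ⟨e0, e1, e2⟩ p
    simp
    linear_combination 2 * p 0 * e0 + 2 * p 1 * e1 + 2 * p 2 * e2

/-! ### Invariance of the types of curves -/

/-- The linear change of coordinates with matrix `g`, as an automorphism of the polynomial ring. -/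
def changeVars (g : Matrix.GeneralLinearGroup (Fin 3) ℂ) :
    MvPolynomial (Fin 3) ℂ ≃ₐ[ℂ] MvPolynomial (Fin 3) ℂ :=
  AlgEquiv.ofAlgHom
    (bind₁ fun i => linearForm fun j => (g : Matrix (Fin 3) (Fin 3) ℂ) i j)
    (bind₁ fun i => linearForm fun j => (↑g⁻¹ : Matrix (Fin 3) (Fin 3) ℂ) i j)
    (AlgHom.ext fun P => MvPolynomial.funext fun p => by
      rw [AlgHom.comp_apply, eval_bind₁_linearForm, eval_bind₁_linearForm, Matrix.mulVec_mulVec,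
        ← Units.val_mul]
      simp)
    (AlgHom.ext fun P => MvPolynomial.funext fun p => by
      rw [AlgHom.comp_apply, eval_bind₁_linearForm, eval_bind₁_linearForm, Matrix.mulVec_mulVec,
        ← Units.val_mul]
      simp)

theorem irreducible_bind₁ {F : MvPolynomial (Fin 3) ℂ} (hF : Irreducible F)
    (g : Matrix.GeneralLinearGroup (Fin 3) ℂ) :
    Irreducible (bind₁ (fun i => linearForm fun j => (g : Matrix (Fin 3) (Fin 3) ℂ) i j) F) :=
  (MulEquiv.irreducible_iff (changeVars g)).2 hF

theorem linearIndependent_vecMul {n : ℕ} {l : Fin n → Fin 3 → ℂ} (hl : LinearIndependent ℂ l)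
    (g : Matrix.GeneralLinearGroup (Fin 3) ℂ) :
    LinearIndependent ℂ fun k => Matrix.vecMul (l k) (g : Matrix (Fin 3) (Fin 3) ℂ) :=
  hl.map' (Matrix.vecMulLinear _) <| LinearMap.ker_eq_bot'.2 fun _ hv =>
    Matrix.eq_zero_of_vecMul_eq_zero g.det_ne_zero hv

theorem linearIndependent_mulVec {n : ℕ} {l : Fin n → Fin 3 → ℂ} (hl : LinearIndependent ℂ l)
    (g : Matrix.GeneralLinearGroup (Fin 3) ℂ) :
    LinearIndependent ℂ fun k => Matrix.mulVec (g : Matrix (Fin 3) (Fin 3) ℂ) (l k) :=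
  hl.map' (Matrix.mulVecLin _) <| LinearMap.ker_eq_bot'.2 fun _ hv =>
    Matrix.eq_zero_of_mulVec_eq_zero g.det_ne_zero hv

/-- The chain rule for a linear substitution. -/
theorem pderiv_bind₁_linearForm (M : Matrix (Fin 3) (Fin 3) ℂ) (F : MvPolynomial (Fin 3) ℂ)
    (i : Fin 3) : pderiv i (bind₁ (fun i => linearForm fun j => M i j) F) =
      ∑ j, C (M j i) * bind₁ (fun i => linearForm fun j => M i j) (pderiv j F) := by
  induction F using MvPolynomial.induction_on with
  | C a => simp
  | add P Q hP hQ => simp [hP, hQ, mul_add, Finset.sum_add_distrib]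
  | mul_X P k hP =>
    have hX : pderiv i (linearForm fun j => M k j) = C (M k i) := by
      simp [linearForm, pderiv_X, Pi.single_apply]
    set T := bind₁ (fun i => linearForm fun j => M i j) with hT
    have hk (j : Fin 3) : T (pderiv j (P * X k)) =
        T P * (if k = j then 1 else 0) + T (pderiv j P) * linearForm fun j => M k j := by
      rw [pderiv_mul, map_add, map_mul, map_mul, hT, bind₁_X_right, pderiv_X, Pi.single_apply]
      split_ifs <;> simp [add_comm]
    simp only [hk]
    rw [map_mul, hT, bind₁_X_right, ← hT, pderiv_mul, hX, hP]
    simp only [mul_add, Finset.sum_add_distrib, Finset.sum_mul, mul_ite, mul_one, mul_zero,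
      Finset.sum_ite_eq, Finset.mem_univ, if_true]
    rw [add_comm, mul_comm (C _)]
    congr 1
    exact Finset.sum_congr rfl fun _ _ => mul_assoc _ _ _

theorem LinEquiv.smoothCurve {F G : MvPolynomial (Fin 3) ℂ} (h : LinEquiv G F)
    (hF : SmoothCurve F) : SmoothCurve G := by
  obtain ⟨g, hg⟩ := h
  have hdet := g.det_ne_zero
  generalize (g : Matrix (Fin 3) (Fin 3) ℂ) = M at hg hdet
  subst hg
  intro p hp hp0
  rw [eval_bind₁_linearForm] at hp0
  obtain ⟨j, hj⟩ := hF _ (fun h0 => hp (Matrix.eq_zero_of_mulVec_eq_zero hdet h0)) hp0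
  by_contra! hall
  have hv : Matrix.vecMul (fun j => eval (M.mulVec p) (pderiv j F)) M = 0 := by
    funext i
    have := hall i
    rw [pderiv_bind₁_linearForm, map_sum] at this
    simpa [eval_bind₁_linearForm, Matrix.vecMul, dotProduct, mul_comm] using this
  exact hj (congrFun (Matrix.eq_zero_of_vecMul_eq_zero hdet hv) j)

/-- The types of curves that occur as degenerate loci. -/
def CurveType.IsLocusType : CurveType → Prop
  | .tripleLine | .doubleLinePlusLine | .triangle | .conicPlusTransversalLine | .smooth
  | .irreducibleSmooth | .irreducibleSingular => True
  | _ => False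

theorem LinEquiv.describes {T : CurveType} (hT : T.IsLocusType) {F G : MvPolynomial (Fin 3) ℂ}
    (h : LinEquiv G F) (hF : T.Describes F) : T.Describes G := by
  have hsymm := h.symm
  have hGF := h
  obtain ⟨g, rfl⟩ := h
  cases T with
  | tripleLine =>
    obtain ⟨l, hl, rfl⟩ := hF
    exact ⟨Matrix.vecMul l g, fun h0 => hl (Matrix.eq_zero_of_vecMul_eq_zero g.det_ne_zero h0),
      by rw [map_pow, bind₁_linearForm]⟩
  | doubleLinePlusLine =>
    obtain ⟨l, m, hlm, rfl⟩ := hF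
    refine ⟨Matrix.vecMul l g, Matrix.vecMul m g, ?_,
      by rw [map_mul, map_pow, bind₁_linearForm, bind₁_linearForm]⟩
    convert linearIndependent_vecMul hlm g using 1
    ext i : 1
    fin_cases i <;> rfl
  | triangle =>
    obtain ⟨l₁, l₂, l₃, hl, rfl⟩ := hF
    refine ⟨Matrix.vecMul l₁ g, Matrix.vecMul l₂ g, Matrix.vecMul l₃ g, ?_,
      by simp only [map_mul, bind₁_linearForm]⟩
    convert linearIndependent_vecMul hl g using 1
    ext i : 1
    fin_cases i <;> rfl
  | conicPlusTransversalLine =>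
    obtain ⟨l, q, hl, hq, hirr, rfl, p₁, p₂, hp, h1, h2, h3, h4⟩ := hF
    have hinv (p : Fin 3 → ℂ) : Matrix.mulVec (g : Matrix (Fin 3) (Fin 3) ℂ)
        (Matrix.mulVec (↑g⁻¹ : Matrix (Fin 3) (Fin 3) ℂ) p) = p := by
      rw [Matrix.mulVec_mulVec, ← Units.val_mul]
      simp
    refine ⟨Matrix.vecMul l g, _,
      fun h0 => hl (Matrix.eq_zero_of_vecMul_eq_zero g.det_ne_zero h0),
      LinEquiv.isHomogeneous ⟨g, rfl⟩ hq, irreducible_bind₁ hirr g,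
      by rw [map_mul, bind₁_linearForm],
      Matrix.mulVec (↑g⁻¹ : Matrix (Fin 3) (Fin 3) ℂ) p₁,
      Matrix.mulVec (↑g⁻¹ : Matrix (Fin 3) (Fin 3) ℂ) p₂, ?_, ?_, ?_, ?_, ?_⟩
    · convert linearIndependent_mulVec hp g⁻¹ using 1
      ext i : 1
      fin_cases i <;> rfl
    · rwa [← bind₁_linearForm, eval_bind₁_linearForm, hinv]
    · rwa [eval_bind₁_linearForm, hinv]
    · rwa [← bind₁_linearForm, eval_bind₁_linearForm, hinv]
    · rwa [eval_bind₁_linearForm, hinv]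
  | smooth => exact hGF.smoothCurve hF
  | irreducibleSmooth => exact ⟨irreducible_bind₁ hF.1 g, hGF.smoothCurve hF.2⟩
  | irreducibleSingular =>
    exact ⟨irreducible_bind₁ hF.1 g, fun h => hF.2 (hsymm.smoothCurve h)⟩
  | _ => exact hT.elim

/-- It suffices to compute the degenerate locus in one basis of the right kernel. -/
theorem degenerateLocusIs_of_basis {φ : MvPolynomial (Fin 3) ℂ} {T : CurveType}
    (hT : T.IsLocusType) (A : Fin 3 → Matrix (Fin 3) (Fin 3) ℂ)
    (hker : ∀ Q, Q ∈ rightKernel φ ↔ ∃ x y z : ℂ, Q = x • A 0 + y • A 1 + z • A 2)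
    (hli : ∀ x y z : ℂ, x • A 0 + y • A 1 + z • A 2 = 0 → x = 0 ∧ y = 0 ∧ z = 0)
    (D : MvPolynomial (Fin 3) ℂ)
    (hD : ∀ x y z : ℂ, eval ![x, y, z] D = (x • A 0 + y • A 1 + z • A 2).det)
    (hTD : T.Describes D) : DegenerateLocusIs φ T := by
  have hA (k : Fin 3) : A k ∈ rightKernel φ := by
    rw [hker]
    fin_cases k
    exacts [⟨1, 0, 0, by simp⟩, ⟨0, 1, 0, by simp⟩, ⟨0, 0, 1, by simp⟩]
  have hLI : LinearIndependent ℂ fun k => (⟨A k, hA k⟩ : rightKernel φ) := by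
    refine Fintype.linearIndependent_iff.2 fun u hu i => ?_
    have h0 := congrArg Subtype.val hu
    rw [Fin.sum_univ_three] at h0
    obtain ⟨h1, h2, h3⟩ := hli _ _ _ h0
    fin_cases i <;> assumption
  have hspan : ⊤ ≤ Submodule.span ℂ (Set.range fun k => (⟨A k, hA k⟩ : rightKernel φ)) := by
    rintro ⟨Q, hQ⟩ -
    obtain ⟨x, y, z, rfl⟩ := (hker Q).1 hQ
    refine (Submodule.mem_span_range_iff_exists_fun ℂ).2 ⟨![x, y, z], Subtype.ext ?_⟩
    simp [Fin.sum_univ_three]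
  let b₀ := Module.Basis.mk hLI hspan
  have hb₀ (k : Fin 3) : (b₀ k : Matrix (Fin 3) (Fin 3) ℂ) = A k := by
    rw [Module.Basis.mk_apply]
  refine ⟨by rw [Module.finrank_eq_card_basis b₀, Fintype.card_fin], fun b => ?_⟩
  -- Passing to another basis of the kernel substitutes linear forms, given by the transition
  -- matrix, for the variables of the determinant.
  refine LinEquiv.describes hT (linEquiv_iff.2 ⟨b₀.toMatrix b, ?_, fun p => ?_⟩) hTD
  · have : (b₀.toMatrix b * b.toMatrix b₀).det = 1 := by
      rw [Module.Basis.toMatrix_mul_toMatrix_flip, Matrix.det_one]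
    rw [Matrix.det_mul] at this
    exact left_ne_zero_of_mul_eq_one this
  · have hp (q : Fin 3 → ℂ) : q = ![q 0, q 1, q 2] := by
      ext i
      fin_cases i <;> rfl
    have hsum (k : Fin 3) : (b k : Matrix (Fin 3) (Fin 3) ℂ) = ∑ i, b₀.toMatrix b i k • A i := by
      have := congrArg Subtype.val (b₀.sum_toMatrix_smul_self b k)
      rw [← this, AddSubmonoidClass.coe_finsetSum]
      exact Finset.sum_congr rfl fun i _ => by rw [Submodule.coe_smul, hb₀]
    rw [hp (Matrix.mulVec _ p), hD, degenerateLocus, RingHom.map_det]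
    congr 1
    ext i j
    simp [hsum, Fin.sum_univ_three, Matrix.mulVec, dotProduct, Matrix.add_apply]
    ring

/-! ### Irreducibility and smoothness of the normal forms -/

/-- The plane cubic `ky²z + Ax³ + Bx²z + Cxz² + Dz³`. -/
def generalWeierstrass (k A B C D : ℂ) : MvPolynomial (Fin 3) ℂ :=
  ternaryCubic ![A, 0, D, 0, B, 0, k, C, 0, 0]

theorem eval_generalWeierstrass (k A B C D : ℂ) (p : Fin 3 → ℂ) :
    eval p (generalWeierstrass k A B C D) = k * p 1 ^ 2 * p 2 + A * p 0 ^ 3 + B * p 0 ^ 2 * p 2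
      + C * p 0 * p 2 ^ 2 + D * p 2 ^ 3 := by
  simp [generalWeierstrass, eval_ternaryCubic]
  ring

theorem weierstrass_eq (a b : ℂ) : weierstrass a b = generalWeierstrass 1 (-1) 0 (-a) (-b) := by
  simp [weierstrass, generalWeierstrass]

theorem irreducible_generalWeierstrass {k A B C D : ℂ} (hk : k ≠ 0) (hA : A ≠ 0) :
    Irreducible (generalWeierstrass k A B C D) := by
  refine irreducible_of_forall_linear (isHomogeneous_ternaryCubic _) (by norm_num) le_rfl
    (fun h => ?_) fun l hl => ?_
  · have := eval_generalWeierstrass k A B C D ![1, 0, 0]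
    rw [h] at this
    simp [hA.symm] at this
  · simp only [Fin.sum_univ_three, eval_generalWeierstrass] at hl
    have h1 : l 1 = 0 := by
      have := hl ![l 1, -l 0, 0] (by simp; ring)
      simpa [hA] using this
    have h0 : l 0 = 0 := by
      have e0 := hl ![l 2, 0, -l 0] (by simp; ring)
      have e1 := hl ![l 2, 1, -l 0] (by simp [h1]; ring)
      simp at e0 e1
      have : k * l 0 = 0 := by linear_combination e0 - e1
      simpa [hk] using this
    have h2 : l 2 = 0 := by
      by_contra h2
      have := hl ![1, 0, 0] (by simp [h0])
      simp [hA] at this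
    funext i
    fin_cases i <;> assumption

theorem eval_pderiv_generalWeierstrass (k A B C D : ℂ) (p : Fin 3 → ℂ) :
    eval p (pderiv 0 (generalWeierstrass k A B C D)) =
      3 * A * p 0 ^ 2 + 2 * B * p 0 * p 2 + C * p 2 ^ 2 ∧
    eval p (pderiv 1 (generalWeierstrass k A B C D)) = 2 * k * p 1 * p 2 ∧
    eval p (pderiv 2 (generalWeierstrass k A B C D)) =
      k * p 1 ^ 2 + B * p 0 ^ 2 + 2 * C * p 0 * p 2 + 3 * D * p 2 ^ 2 := by
  rw [generalWeierstrass, pderiv_zero_ternaryCubic, pderiv_one_ternaryCubic,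
    pderiv_two_ternaryCubic]
  simp
  ring

/-- The y-derivative 2kyz confines singular points to z = 0 or y = 0. The only point at infinity, (0
: 1 : 0), is smooth; on y = 0 a singular point is a double root of the cubic in x. -/
theorem smoothCurve_generalWeierstrass {k A B C D : ℂ} (hk : k ≠ 0) (hA : A ≠ 0)
    (h : ∀ t, A * t ^ 3 + B * t ^ 2 + C * t + D = 0 → 3 * A * t ^ 2 + 2 * B * t + C ≠ 0) :
    SmoothCurve (generalWeierstrass k A B C D) := by
  intro p hp hp0
  by_contra! hsing
  obtain ⟨d0, d1, d2⟩ := eval_pderiv_generalWeierstrass k A B C D p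
  rw [eval_generalWeierstrass] at hp0
  rw [hsing] at d0 d1 d2
  by_cases hz : p 2 = 0
  · have hx : p 0 = 0 := by simpa [hz, hA] using hp0
    have hy : p 1 = 0 := by simpa [hz, hx, hk] using d2.symm
    exact hp (funext fun i => by fin_cases i <;> assumption)
  · have hy : p 1 = 0 := by simpa [hz, hk] using d1.symm
    rw [hy] at hp0
    refine h (p 0 / p 2) ?_ ?_
    · field_simp
      linear_combination hp0
    · field_simp
      linear_combination -d0

theorem not_smoothCurve_generalWeierstrass {k A B C D : ℂ} (t : ℂ)
    (h : A * t ^ 3 + B * t ^ 2 + C * t + D = 0) (h' : 3 * A * t ^ 2 + 2 * B * t + C = 0) :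
    ¬ SmoothCurve (generalWeierstrass k A B C D) := by
  intro hs
  obtain ⟨d0, d1, d2⟩ := eval_pderiv_generalWeierstrass k A B C D ![t, 0, 1]
  obtain ⟨i, hi⟩ := hs ![t, 0, 1] (fun h0 => by simpa using congrFun h0 2)
    (by rw [eval_generalWeierstrass]; simp; linear_combination h)
  refine hi ?_
  fin_cases i
  · refine d0.trans ?_
    simp
    linear_combination h'
  · refine d1.trans ?_
    simp
  · refine d2.trans ?_
    simp
    linear_combination 3 * h - t * h'

theorem irreducible_conic {c d : ℂ} (hc : c ≠ 0) (hd : d ≠ 0) :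
    Irreducible (C c * X 0 ^ 2 + C d * X 1 * X 2 : MvPolynomial (Fin 3) ℂ) ∧
      (C c * X 0 ^ 2 + C d * X 1 * X 2 : MvPolynomial (Fin 3) ℂ).IsHomogeneous 2 := by
  have hhom : (C c * X 0 ^ 2 + C d * X 1 * X 2 : MvPolynomial (Fin 3) ℂ).IsHomogeneous 2 :=
    ((isHomogeneous_C _ c).mul ((isHomogeneous_X ℂ 0).pow 2)).add
      (((isHomogeneous_C _ d).mul (isHomogeneous_X ℂ 1)).mul (isHomogeneous_X ℂ 2))
  refine ⟨irreducible_of_forall_linear hhom le_rfl (by norm_num) (fun h => ?_) fun l hl => ?_, hhom⟩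
  · have := congrArg (eval ![1, 0, 0]) h
    simp [hc] at this
  · simp only [Fin.sum_univ_three] at hl
    have h1 : l 1 = 0 := by
      have := hl ![l 1, -l 0, 0] (by simp; ring)
      simpa [hc] using this
    have h2 : l 2 = 0 := by
      have := hl ![l 2, 0, -l 0] (by simp; ring)
      simpa [hc] using this
    have h0 : l 0 = 0 := by
      by_contra h0
      have := hl ![0, 1, 1] (by simp [h1, h2])
      simp [hd] at this
    funext i
    fin_cases i <;> assumption

/-! ### The degenerate loci -/

/-- The determinant of the general kernel element is again a Weierstrass cubic, degenerating when a
= 0. All rows in Weierstrass form are read off from it. -/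
theorem degenerateLocusIs_weierstrass {a b : ℂ} {T : CurveType} (hT : T.IsLocusType)
    (hTD : T.Describes
      (generalWeierstrass (-1) (-2 * a) (-3 * b) (-(2 * a ^ 2 / 3)) (-(a * b)))) :
    DegenerateLocusIs (weierstrass a b) T := by
  refine degenerateLocusIs_of_basis hT ![!![0, 0, 1; 0, 2 * a, 0; 1, 0, 0],
    !![0, 1, 0; 1, 0, 0; 0, 0, 0], !![-a / 3, 0, 0; 0, 3 * b, 0; 0, 0, 1]] (fun Q => ?_)
    (fun x y z h => ?_) _ (fun x y z => ?_) hTD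
  · rw [weierstrass, mem_rightKernel_ternaryCubic]
    simp
    constructor
    · rintro ⟨⟨h1, h2, h3⟩, e0, e1, e2⟩
      refine ⟨Q 0 2, Q 0 1, Q 2 2, ?_⟩
      ext i j
      fin_cases i <;> fin_cases j <;> simp <;> grind
    · rintro ⟨x, y, z, rfl⟩
      simp
      constructor <;> ring
  · have h0 := congrFun₂ h 0 2
    have h1 := congrFun₂ h 0 1
    have h2 := congrFun₂ h 2 2
    simp at h0 h1 h2
    exact ⟨h0, h1, h2⟩
  · rw [eval_generalWeierstrass, Matrix.det_fin_three]
    simp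
    ring

theorem degenerateLocusIs_weierstrass_smooth {a b : ℂ} (ha : a ≠ 0)
    (hab : 4 * a ^ 3 + 27 * b ^ 2 ≠ 0) :
    DegenerateLocusIs (weierstrass a b) .irreducibleSmooth := by
  have hA : -2 * a ≠ 0 := mul_ne_zero (by norm_num) ha
  refine degenerateLocusIs_weierstrass trivial ⟨irreducible_generalWeierstrass (by norm_num) hA,
    smoothCurve_generalWeierstrass (by norm_num) hA fun t h h' => ?_⟩
  -- Euclid's algorithm on the cubic and its derivative: `g1` is the derivative up to a scalar, `g2`
  -- comes from a linear remainder, and eliminating t leaves a multiple of the squared discriminant.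
  have g1 : 9 * a * t ^ 2 + 9 * b * t + a ^ 2 = 0 := by linear_combination -3 / 2 * h'
  have g2 : (4 * a ^ 3 - 9 * b ^ 2) * t + 8 * a ^ 2 * b = 0 := by
    linear_combination -a * (9 * h - 3 * t * h') - b * g1
  have : a ^ 2 * (4 * a ^ 3 + 27 * b ^ 2) ^ 2 = 0 := by
    linear_combination (4 * a ^ 3 - 9 * b ^ 2) ^ 2 * g1
      - (9 * a * ((4 * a ^ 3 - 9 * b ^ 2) * t - 8 * a ^ 2 * b)
        + 9 * b * (4 * a ^ 3 - 9 * b ^ 2)) * g2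
  exact mul_ne_zero (pow_ne_zero 2 ha) (pow_ne_zero 2 hab) this

theorem degenerateLocusIs_weierstrass_singular {a : ℂ} (ha : a ^ 3 = -27 / 4) :
    DegenerateLocusIs (weierstrass a 1) .irreducibleSingular := by
  have ha0 : a ≠ 0 := by
    rintro rfl
    norm_num at ha
  have hA : -2 * a ≠ 0 := mul_ne_zero (by norm_num) ha0
  refine degenerateLocusIs_weierstrass trivial ⟨irreducible_generalWeierstrass (by norm_num) hA,
    -- This value is a root of the cubic for every a ≠ 0; the condition on a³ makes it a double
    -- root.
    not_smoothCurve_generalWeierstrass (-3 / (2 * a)) ?_ ?_⟩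
  · field_simp
    ring
  · field_simp
    linear_combination -4 * ha

theorem linearIndependent_pair {u v : Fin 3 → ℂ}
    (h : ∀ s t : ℂ, (∀ i, s * u i + t * v i = 0) → s = 0 ∧ t = 0) :
    LinearIndependent ℂ ![u, v] :=
  LinearIndependent.pair_iff.2 fun s t hst => h s t fun i => congrFun hst i

theorem linearIndependent_triple {u v w : Fin 3 → ℂ}
    (h : ∀ r s t : ℂ, (∀ i, r * u i + s * v i + t * w i = 0) → r = 0 ∧ s = 0 ∧ t = 0) :
    LinearIndependent ℂ ![u, v, w] := by
  refine Fintype.linearIndependent_iff.2 fun g hg i => ?_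
  obtain ⟨h1, h2, h3⟩ := h (g 0) (g 1) (g 2) fun i => by
    simpa [Fin.sum_univ_three] using congrFun hg i
  fin_cases i <;> assumption

theorem degenerateLocusIs_fermat : DegenerateLocusIs (weierstrass 0 1) .triangle := by
  obtain ⟨w, hw⟩ : ∃ w : ℂ, w ^ 2 = -3 := IsAlgClosed.exists_pow_nat_eq _ (by norm_num)
  have hw0 : w ≠ 0 := by
    rintro rfl
    norm_num at hw
  refine degenerateLocusIs_weierstrass trivial ⟨![0, 0, -1], ![w, 1, 0], ![-w, 1, 0],
    linearIndependent_triple fun r s t h => ?_, MvPolynomial.funext fun p => ?_⟩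
  · have h0 := h 0
    have h1 := h 1
    have h2 := h 2
    simp at h0 h1 h2
    have : w * (s - t) = 0 := by linear_combination h0
    have hst : s - t = 0 := by simpa [hw0] using this
    exact ⟨h2, by linear_combination (h1 + hst) / 2, by linear_combination (h1 - hst) / 2⟩
  · simp [eval_generalWeierstrass, eval_linearForm, Fin.sum_univ_three]
    linear_combination -p 2 * p 0 ^ 2 * hw

theorem degenerateLocusIs_cusp : DegenerateLocusIs (weierstrass 0 0) .doubleLinePlusLine := by
  refine degenerateLocusIs_weierstrass trivial ⟨![0, 1, 0], ![0, 0, -1],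
    linearIndependent_pair fun s t h => ?_, MvPolynomial.funext fun p => ?_⟩
  · simpa using And.intro (h 1) (h 2)
  · simp [eval_generalWeierstrass, eval_linearForm, Fin.sum_univ_three]

theorem degenerateLocusIs_triangle :
    DegenerateLocusIs (ternaryCubic ![0, 0, 0, 0, 0, 0, 0, 0, 0, 1]) .triangle := by
  refine degenerateLocusIs_of_basis trivial ![!![1, 0, 0; 0, 0, 0; 0, 0, 0],
    !![0, 0, 0; 0, 1, 0; 0, 0, 0], !![0, 0, 0; 0, 0, 0; 0, 0, 1]] (fun Q => ?_)
    (fun x y z h => ?_) (X 0 * X 1 * X 2) (fun x y z => ?_) ⟨![1, 0, 0], ![0, 1, 0], ![0, 0, 1],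
      linearIndependent_triple fun r s t h => ?_, MvPolynomial.funext fun p => ?_⟩
  · rw [mem_rightKernel_ternaryCubic]
    simp
    constructor
    · rintro ⟨⟨h1, h2, h3⟩, e0, e1, e2⟩
      refine ⟨Q 0 0, Q 1 1, Q 2 2, ?_⟩
      ext i j
      fin_cases i <;> fin_cases j <;> simp <;> grind
    · rintro ⟨x, y, z, rfl⟩
      simp
  · have h0 := congrFun₂ h 0 0
    have h1 := congrFun₂ h 1 1
    have h2 := congrFun₂ h 2 2
    simp at h0 h1 h2
    exact ⟨h0, h1, h2⟩
  · rw [Matrix.det_fin_three]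
    simp
  · simpa using And.intro (h 0) (And.intro (h 1) (h 2))
  · simp [eval_linearForm, Fin.sum_univ_three]

theorem degenerateLocusIs_conicPlusTransversalLine :
    DegenerateLocusIs (ternaryCubic ![1, 0, 0, 0, 0, 0, 0, 0, 0, 1]) .conicPlusTransversalLine := by
  obtain ⟨hirr, hhom⟩ := irreducible_conic (c := -9) (d := 1) (by norm_num) one_ne_zero
  refine degenerateLocusIs_of_basis trivial ![!![1, 0, 0; 0, 0, -3; 0, -3, 0],
    !![0, 0, 0; 0, 1, 0; 0, 0, 0], !![0, 0, 0; 0, 0, 0; 0, 0, 1]] (fun Q => ?_)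
    (fun x y z h => ?_) (X 0 * (C (-9) * X 0 ^ 2 + C 1 * X 1 * X 2)) (fun x y z => ?_)
    ⟨![1, 0, 0], _, fun h => by simpa using congrFun h 0, hhom, hirr,
      MvPolynomial.funext fun p => ?_, ![0, 1, 0], ![0, 0, 1],
      linearIndependent_pair fun s t h => ?_, ?_, ?_, ?_, ?_⟩
  · rw [mem_rightKernel_ternaryCubic]
    simp
    constructor
    · rintro ⟨⟨h1, h2, h3⟩, e0, e1, e2⟩
      refine ⟨Q 0 0, Q 1 1, Q 2 2, ?_⟩
      ext i j
      fin_cases i <;> fin_cases j <;> simp <;> grind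
    · rintro ⟨x, y, z, rfl⟩
      simp
      ring
  · have h0 := congrFun₂ h 0 0
    have h1 := congrFun₂ h 1 1
    have h2 := congrFun₂ h 2 2
    simp at h0 h1 h2
    exact ⟨h0, h1, h2⟩
  · rw [Matrix.det_fin_three]
    simp
    ring
  · simp [eval_linearForm, Fin.sum_univ_three]
  · simpa using And.intro (h 1) (h 2)
  all_goals simp [eval_linearForm, Fin.sum_univ_three]

theorem degenerateLocusIs_conicPlusTangentLine :
    DegenerateLocusIs (ternaryCubic ![0, 0, 0, 1, 0, 0, 1, 0, 0, 0]) .tripleLine := by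
  obtain ⟨w, hw⟩ : ∃ w : ℂ, w ^ 3 = -(1 / 4) := IsAlgClosed.exists_pow_nat_eq _ (by norm_num)
  have hw0 : w ≠ 0 := by
    rintro rfl
    norm_num at hw
  refine degenerateLocusIs_of_basis trivial ![!![1, 0, 0; 0, 0, -1 / 2; 0, -1 / 2, 0],
    !![0, 0, 1; 0, 0, 0; 1, 0, 0], !![0, 0, 0; 0, 0, 0; 0, 0, 1]] (fun Q => ?_)
    (fun x y z h => ?_) (C (-(1 / 4)) * X 0 ^ 3) (fun x y z => ?_)
    ⟨![w, 0, 0], fun h => hw0 (by simpa using congrFun h 0), MvPolynomial.funext fun p => ?_⟩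
  · rw [mem_rightKernel_ternaryCubic]
    simp
    constructor
    · rintro ⟨⟨h1, h2, h3⟩, e0, e1, e2⟩
      refine ⟨Q 0 0, Q 0 2, Q 2 2, ?_⟩
      ext i j
      fin_cases i <;> fin_cases j <;> simp <;> grind
    · rintro ⟨x, y, z, rfl⟩
      simp
      ring
  · have h0 := congrFun₂ h 0 0
    have h1 := congrFun₂ h 0 2
    have h2 := congrFun₂ h 2 2
    simp at h0 h1 h2
    exact ⟨h0, h1, h2⟩
  · rw [Matrix.det_fin_three]
    simp
    ring
  · simp [eval_linearForm, Fin.sum_univ_three, mul_pow, hw]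

/-! ### The normal forms in coordinates -/

theorem tripleLine_eq : (X 0 ^ 3 : MvPolynomial (Fin 3) ℂ) =
    ternaryCubic ![1, 0, 0, 0, 0, 0, 0, 0, 0, 0] :=
  ternaryCubic_eq_iff.2 fun x y z => by simp [eval_ternaryCubic]

theorem threeConcurrentLines_eq : (X 0 * X 1 * (X 0 + X 1) : MvPolynomial (Fin 3) ℂ) =
    ternaryCubic ![0, 0, 0, 1, 0, 1, 0, 0, 0, 0] :=
  ternaryCubic_eq_iff.2 fun x y z => by simp [eval_ternaryCubic]; ring

theorem doubleLinePlusLine_eq : (X 0 ^ 2 * X 1 : MvPolynomial (Fin 3) ℂ) =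
    ternaryCubic ![0, 0, 0, 1, 0, 0, 0, 0, 0, 0] :=
  ternaryCubic_eq_iff.2 fun x y z => by simp [eval_ternaryCubic]

theorem irreducible₁_eq : (X 1 ^ 2 * X 2 - X 0 ^ 3 - X 2 ^ 3 : MvPolynomial (Fin 3) ℂ) =
    weierstrass 0 1 :=
  ternaryCubic_eq_iff.2 fun x y z => by simp [eval_ternaryCubic]; ring

theorem irreducible₂_eq : (X 1 ^ 2 * X 2 - X 0 ^ 3 - X 0 * X 2 ^ 2 : MvPolynomial (Fin 3) ℂ) =
    weierstrass 1 0 :=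
  ternaryCubic_eq_iff.2 fun x y z => by simp [eval_ternaryCubic]; ring

theorem cusp_eq : (X 1 ^ 2 * X 2 - X 0 ^ 3 : MvPolynomial (Fin 3) ℂ) = weierstrass 0 0 :=
  ternaryCubic_eq_iff.2 fun x y z => by simp [eval_ternaryCubic]; ring

theorem triangle_eq : (X 0 * X 1 * X 2 : MvPolynomial (Fin 3) ℂ) =
    ternaryCubic ![0, 0, 0, 0, 0, 0, 0, 0, 0, 1] :=
  ternaryCubic_eq_iff.2 fun x y z => by simp [eval_ternaryCubic]

theorem conicPlusTransversalLine_eq :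
    (X 0 * (X 0 ^ 2 + X 1 * X 2) : MvPolynomial (Fin 3) ℂ) =
      ternaryCubic ![1, 0, 0, 0, 0, 0, 0, 0, 0, 1] :=
  ternaryCubic_eq_iff.2 fun x y z => by simp [eval_ternaryCubic]; ring

theorem conicPlusTangentLine_eq :
    (X 1 * (X 0 ^ 2 + X 1 * X 2) : MvPolynomial (Fin 3) ℂ) =
      ternaryCubic ![0, 0, 0, 1, 0, 0, 1, 0, 0, 0] :=
  ternaryCubic_eq_iff.2 fun x y z => by simp [eval_ternaryCubic]; ring

theorem weierstrass_one_eq (a : ℂ) :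
    (X 1 ^ 2 * X 2 - X 0 ^ 3 - C a * X 0 * X 2 ^ 2 - X 2 ^ 3 : MvPolynomial (Fin 3) ℂ) =
      weierstrass a 1 :=
  ternaryCubic_eq_iff.2 fun x y z => by simp [eval_ternaryCubic]; ring

/-! ### Classification -/

/-- `φ` is equivalent to a normal form of the table. -/
def HasNormalForm (φ : MvPolynomial (Fin 3) ℂ) : Prop :=
  ∃ row : Row, Table row ∧ LinEquiv φ row.normalForm

theorem HasNormalForm.of_linEquiv {φ ψ : MvPolynomial (Fin 3) ℂ} (hψ : HasNormalForm ψ)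
    (h : LinEquiv φ ψ) : HasNormalForm φ := by
  obtain ⟨row, hrow, h'⟩ := hψ
  exact ⟨row, hrow, h.trans h'⟩

theorem Table.hasNormalForm {row : Row} (h : Table row) {φ : MvPolynomial (Fin 3) ℂ}
    (hφ : row.normalForm = φ) : HasNormalForm φ :=
  ⟨row, h, hφ ▸ LinEquiv.refl _⟩

theorem linEquiv_of_eval {φ ψ : MvPolynomial (Fin 3) ℂ} (M : Matrix (Fin 3) (Fin 3) ℂ)
    (hM : M.det ≠ 0)
    (h : ∀ x y z, eval ![x, y, z] φ = eval ![M 0 0 * x + M 0 1 * y + M 0 2 * z,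
      M 1 0 * x + M 1 1 * y + M 1 2 * z, M 2 0 * x + M 2 1 * y + M 2 2 * z] ψ) :
    LinEquiv φ ψ := by
  refine linEquiv_iff.2 ⟨M, hM, fun p => ?_⟩
  have hp : p = ![p 0, p 1, p 2] := by
    ext i
    fin_cases i <;> rfl
  have hMp : M.mulVec p = ![M 0 0 * p 0 + M 0 1 * p 1 + M 0 2 * p 2,
      M 1 0 * p 0 + M 1 1 * p 1 + M 1 2 * p 2, M 2 0 * p 0 + M 2 1 * p 1 + M 2 2 * p 2] := by
    ext i
    fin_cases i <;> simp [Matrix.mulVec, dotProduct, Fin.sum_univ_three]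
  rw [hMp, ← h, ← hp]

/-! ### Cubics in Weierstrass form -/

theorem linEquiv_weierstrass_of_scaling {a b μ ν : ℂ} (h : μ ^ 2 * ν = 1) :
    LinEquiv (weierstrass (a * ν ^ 2) (b * ν ^ 3)) (weierstrass a b) := by
  refine linEquiv_of_eval !![1, 0, 0; 0, μ, 0; 0, 0, ν] ?_ fun x y z => ?_
  · rw [Matrix.det_fin_three]
    simp
    constructor <;> rintro rfl <;> simp at h
  · simp [weierstrass, eval_ternaryCubic]
    linear_combination -(y ^ 2 * z) * h

/-- Scaling changes (a, b) to (aν², bν³), so b can be made 1, or a when b = 0 and a ≠ 0. -/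
theorem hasNormalForm_weierstrass (a b : ℂ) : HasNormalForm (weierstrass a b) := by
  have hsqrt (ν : ℂ) (hν : ν ≠ 0) : ∃ μ : ℂ, μ ^ 2 * ν = 1 := by
    obtain ⟨μ, hμ⟩ := IsAlgClosed.exists_pow_nat_eq ν⁻¹ (n := 2) (by norm_num)
    exact ⟨μ, by rw [hμ, inv_mul_cancel₀ hν]⟩
  by_cases hb : b = 0
  · subst hb
    by_cases ha : a = 0
    · subst ha
      exact Table.cusp.hasNormalForm cusp_eq
    · obtain ⟨ν, hν⟩ := IsAlgClosed.exists_pow_nat_eq a (n := 2) (by norm_num)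
      obtain ⟨μ, hμ⟩ := hsqrt ν (by rintro rfl; simp at hν; exact ha hν.symm)
      have := linEquiv_weierstrass_of_scaling (a := 1) (b := 0) hμ
      rw [hν, one_mul, zero_mul] at this
      exact (Table.irreducible₂.hasNormalForm irreducible₂_eq).of_linEquiv this
  · obtain ⟨ν, hν⟩ := IsAlgClosed.exists_pow_nat_eq b (n := 3) (by norm_num)
    have hν0 : ν ≠ 0 := by rintro rfl; simp at hν; exact hb hν.symm
    obtain ⟨μ, hμ⟩ := hsqrt ν hν0
    have := linEquiv_weierstrass_of_scaling (a := a / ν ^ 2) (b := 1) hμ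
    rw [hν, one_mul, div_mul_cancel₀ _ (pow_ne_zero 2 hν0)] at this
    refine HasNormalForm.of_linEquiv ?_ this
    generalize a / ν ^ 2 = a
    by_cases ha : a = 0
    · subst ha
      exact Table.irreducible₁.hasNormalForm irreducible₁_eq
    · by_cases ha' : a ^ 3 = -27 / 4
      · exact (Table.irreducibleSingular a ha').hasNormalForm (weierstrass_one_eq a)
      · exact (Table.irreducibleSmooth a ha ha').hasNormalForm (weierstrass_one_eq a)

/-- Completing the cube removes the x²z term, and rescaling x and y normalizes the leading
coefficients. -/
theorem hasNormalForm_generalWeierstrass {k A : ℂ} (B C D : ℂ) (hk : k ≠ 0) (hA : A ≠ 0) :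
    HasNormalForm (generalWeierstrass k A B C D) := by
  obtain ⟨κ, hκ⟩ := IsAlgClosed.exists_pow_nat_eq k (n := 2) (by norm_num)
  obtain ⟨α, hα⟩ := IsAlgClosed.exists_pow_nat_eq (-A) (n := 3) (by norm_num)
  have hκ0 : κ ≠ 0 := by rintro rfl; simp at hκ; exact hk hκ.symm
  have hα0 : α ≠ 0 := by rintro rfl; simp at hα; exact hA hα
  obtain ⟨e, he⟩ : ∃ e, 3 * A * e = B := ⟨B / (3 * A), by field_simp⟩
  obtain ⟨a, ha⟩ : ∃ a, a * α = B * e - C := ⟨(B * e - C) / α, by field_simp⟩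
  refine (hasNormalForm_weierstrass a (A * e ^ 3 - a * α * e - D)).of_linEquiv
    (linEquiv_of_eval !![α, 0, α * e; 0, κ, 0; 0, 0, 1] ?_ fun x y z => ?_)
  · rw [Matrix.det_fin_three]
    simp [hα0, hκ0]
  · simp [eval_generalWeierstrass, weierstrass, eval_ternaryCubic]
    linear_combination -(y ^ 2 * z) * hκ + (x + e * z) ^ 3 * hα + x * z ^ 2 * ha
      - (x ^ 2 * z + e * x * z ^ 2) * he

/-- Here (0 : 1 : 0) is a smooth flex with tangent z = 0. Completing the square in y removes the
terms in xyz and yz². -/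
theorem hasNormalForm_flex {c : Fin 10 → ℂ} (h1 : c 1 = 0) (h3 : c 3 = 0) (h5 : c 5 = 0)
    (h0 : c 0 ≠ 0) (h6 : c 6 ≠ 0) : HasNormalForm (ternaryCubic c) := by
  obtain ⟨e, he⟩ : ∃ e, 2 * c 6 * e = c 9 := ⟨c 9 / (2 * c 6), by field_simp⟩
  obtain ⟨f, hf⟩ : ∃ f, 2 * c 6 * f = c 8 := ⟨c 8 / (2 * c 6), by field_simp⟩
  refine (hasNormalForm_generalWeierstrass (c 4 - c 6 * e ^ 2) (c 7 - 2 * c 6 * e * f)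
    (c 2 - c 6 * f ^ 2) h6 h0).of_linEquiv
    (linEquiv_of_eval !![1, 0, 0; e, 1, f; 0, 0, 1] ?_ fun x y z => ?_)
  · rw [Matrix.det_fin_three]
    simp
  · simp [eval_generalWeierstrass, eval_ternaryCubic, h1, h3, h5]
    linear_combination -x * y * z * he - y * z ^ 2 * hf

/-! ### Three concurrent lines and their degenerations -/

/-- The binary cubic `αx³ + βy³ + γx²y + δxy²`. -/
def binaryCubic (α β γ δ : ℂ) : MvPolynomial (Fin 3) ℂ :=
  ternaryCubic ![α, β, 0, γ, 0, δ, 0, 0, 0, 0]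

theorem hasNormalForm_x2y : HasNormalForm (binaryCubic 0 0 1 0) :=
  Table.doubleLinePlusLine.hasNormalForm doubleLinePlusLine_eq

theorem hasNormalForm_binaryCubic_of_dvd {α γ δ : ℂ} (h : α ≠ 0 ∨ γ ≠ 0 ∨ δ ≠ 0) :
    HasNormalForm (binaryCubic α 0 γ δ) := by
  by_cases hδ : δ = 0
  · subst hδ
    by_cases hγ : γ = 0
    · subst hγ
      have hα : α ≠ 0 := by simpa using h
      obtain ⟨ρ, hρ⟩ := IsAlgClosed.exists_pow_nat_eq α (n := 3) (by norm_num)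
      refine (Table.tripleLine.hasNormalForm tripleLine_eq).of_linEquiv
        (linEquiv_of_eval !![ρ, 0, 0; 0, 1, 0; 0, 0, 1] ?_ fun x y z => ?_)
      · rw [Matrix.det_fin_three]
        simp
        rintro rfl
        simp at hρ
        exact hα hρ.symm
      · simp [binaryCubic, eval_ternaryCubic]
        linear_combination -x ^ 3 * hρ
    · refine hasNormalForm_x2y.of_linEquiv
        (linEquiv_of_eval !![1, 0, 0; α, γ, 0; 0, 0, 1] ?_ fun x y z => ?_)
      · rw [Matrix.det_fin_three]
        simpa using hγ
      · simp [binaryCubic, eval_ternaryCubic]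
        ring
  · obtain ⟨e, he⟩ : ∃ e, 2 * δ * e = γ := ⟨γ / (2 * δ), by field_simp⟩
    by_cases hε : α - δ * e ^ 2 = 0
    · refine hasNormalForm_x2y.of_linEquiv
        (linEquiv_of_eval !![e, 1, 0; δ, 0, 0; 0, 0, 1] ?_ fun x y z => ?_)
      · rw [Matrix.det_fin_three]
        simpa using hδ
      · simp [binaryCubic, eval_ternaryCubic]
        linear_combination x ^ 3 * hε - x ^ 2 * y * he
    -- With u, v = σx ∓ τ(y + ex) one has uv(u + v) = 2σ³x³ − 2στ²x(y + ex)². The constants σ and τ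
    -- match this with the completed square.
    · obtain ⟨σ, hσ⟩ := IsAlgClosed.exists_pow_nat_eq ((α - δ * e ^ 2) / 2) (n := 3) (by norm_num)
      have hσ0 : σ ≠ 0 := by
        rintro rfl
        exact hε (by linear_combination -2 * hσ)
      obtain ⟨τ, hτ⟩ := IsAlgClosed.exists_pow_nat_eq (-δ / (2 * σ)) (n := 2) (by norm_num)
      have hτ' : 2 * σ * τ ^ 2 = -δ := by rw [hτ]; field_simp
      have hτ0 : τ ≠ 0 := by
        rintro rfl
        exact hδ (by linear_combination hτ')
      refine (Table.threeConcurrentLines.hasNormalForm threeConcurrentLines_eq).of_linEquiv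
        (linEquiv_of_eval !![σ - τ * e, -τ, 0; σ + τ * e, τ, 0; 0, 0, 1] ?_ fun x y z => ?_)
      · have : (!![σ - τ * e, -τ, 0; σ + τ * e, τ, 0; 0, 0, 1] : Matrix (Fin 3) (Fin 3) ℂ).det =
            2 * σ * τ := by
          rw [Matrix.det_fin_three]
          simp
          ring
        rw [this]
        exact mul_ne_zero (mul_ne_zero two_ne_zero hσ0) hτ0
      · simp [binaryCubic, eval_ternaryCubic]
        linear_combination -2 * x ^ 3 * hσ + x * (y + e * x) ^ 2 * hτ' - x ^ 2 * y * he

theorem hasNormalForm_binaryCubic {α β γ δ : ℂ} (h : α ≠ 0 ∨ β ≠ 0 ∨ γ ≠ 0 ∨ δ ≠ 0) :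
    HasNormalForm (binaryCubic α β γ δ) := by
  by_cases hβ : β = 0
  · subst hβ
    exact hasNormalForm_binaryCubic_of_dvd (by simpa using h)
  · obtain ⟨t, ht⟩ : ∃ t, β * t ^ 3 + δ * t ^ 2 + γ * t + α = 0 := by
      have hdeg := Polynomial.degree_cubic (b := δ) (c := γ) (d := α) hβ
      obtain ⟨t, ht⟩ := IsAlgClosed.exists_root (Polynomial.C β * Polynomial.X ^ 3 +
        Polynomial.C δ * Polynomial.X ^ 2 + Polynomial.C γ * Polynomial.X + Polynomial.C α)
        (by rw [hdeg]; decide)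
      exact ⟨t, by simpa [Polynomial.IsRoot] using ht⟩
    refine (hasNormalForm_binaryCubic_of_dvd (α := β) (γ := 3 * β * t + δ)
      (δ := 3 * β * t ^ 2 + 2 * δ * t + γ) (Or.inl hβ)).of_linEquiv
      (linEquiv_of_eval !![-t, 1, 0; 1, 0, 0; 0, 0, 1] ?_ fun x y z => ?_)
    · rw [Matrix.det_fin_three]
      simp
    · simp [binaryCubic, eval_ternaryCubic]
      linear_combination x ^ 3 * ht

/-! ### Cubics singular at (0 : 0 : 1), sorted by tangent cone -/

/-- The plane cubic `z(ax² + by² + dxy) + αx³ + βy³ + γx²y + δxy²`. -/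
def singularCubic (a b d α β γ δ : ℂ) : MvPolynomial (Fin 3) ℂ :=
  ternaryCubic ![α, β, 0, γ, a, δ, b, 0, 0, d]

theorem linEquiv_singularCubic_swap (a b d α β γ δ : ℂ) :
    LinEquiv (singularCubic a b d α β γ δ) (singularCubic b a d β α δ γ) := by
  refine linEquiv_of_eval !![0, 1, 0; 1, 0, 0; 0, 0, 1] ?_ fun x y z => ?_
  · rw [Matrix.det_fin_three]
    simp
  · simp [singularCubic, eval_ternaryCubic]
    ring

theorem hasNormalForm_node_of_ne_zero_left {α : ℂ} (hα : α ≠ 0) :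
    HasNormalForm (singularCubic 0 0 1 α 0 0 0) := by
  obtain ⟨ρ, hρ⟩ := IsAlgClosed.exists_pow_nat_eq α (n := 3) (by norm_num)
  have hρ0 : ρ ≠ 0 := by rintro rfl; simp at hρ; exact hα hρ.symm
  refine (Table.conicPlusTransversalLine.hasNormalForm conicPlusTransversalLine_eq).of_linEquiv
    (linEquiv_of_eval !![ρ, 0, 0; 0, ρ⁻¹, 0; 0, 0, 1] ?_ fun x y z => ?_)
  · rw [Matrix.det_fin_three]
    simpa using hρ0
  · simp [singularCubic, eval_ternaryCubic]
    linear_combination -x ^ 3 * hρ - x * y * z * mul_inv_cancel₀ hρ0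

theorem hasNormalForm_node (α β : ℂ) : HasNormalForm (singularCubic 0 0 1 α β 0 0) := by
  by_cases hβ : β = 0
  · subst hβ
    by_cases hα : α = 0
    · subst hα
      exact Table.triangle.hasNormalForm triangle_eq
    · exact hasNormalForm_node_of_ne_zero_left hα
  · by_cases hα : α = 0
    · subst hα
      exact (hasNormalForm_node_of_ne_zero_left hβ).of_linEquiv (linEquiv_singularCubic_swap ..)
    · obtain ⟨κ, hκ⟩ := IsAlgClosed.exists_pow_nat_eq (-α / β) (n := 3) (by norm_num)
      have hκ' : β * κ ^ 3 = -α := by rw [hκ]; field_simp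
      have hκ0 : κ ≠ 0 := by
        rintro rfl
        exact hα (by linear_combination hκ')
      -- Rotating the node's tangents xy to y² − x² turns αx³ + βy³ into α(2x³ + 6xy²). The shift of
      -- z by −6αx cancels the xy² term, leaving y²z − x²z + 8αx³.
      refine (hasNormalForm_generalWeierstrass (k := 1) (A := 8 * α) (-1) 0 0 one_ne_zero
        (mul_ne_zero (by norm_num) hα)).of_linEquiv (LinEquiv.symm
        (linEquiv_of_eval !![1, 1, 0; -κ, κ, 0; -6 * α * κ⁻¹, 0, κ⁻¹] ?_ fun x y z => ?_))
      · rw [Matrix.det_fin_three]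
        simp [hκ0]
      · simp [singularCubic, eval_generalWeierstrass, eval_ternaryCubic]
        linear_combination -(y - x) ^ 3 * hκ' -
          (x + y) * (y - x) * (z - 6 * α * x) * mul_inv_cancel₀ hκ0

theorem hasNormalForm_singularCubic_xy {d : ℂ} (hd : d ≠ 0) (α β γ δ : ℂ) :
    HasNormalForm (singularCubic 0 0 d α β γ δ) := by
  refine (hasNormalForm_node α β).of_linEquiv
    (linEquiv_of_eval !![1, 0, 0; 0, 1, 0; γ, δ, d] ?_ fun x y z => ?_)
  · rw [Matrix.det_fin_three]
    simpa using hd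
  · simp [singularCubic, eval_ternaryCubic]
    ring

/-- The new z absorbs the multiples of y². What remains is y² times a line, a conic with a tangent
line, or, when α ≠ 0, a cusp after completing the cube. -/
theorem hasNormalForm_singularCubic_sq {b : ℂ} (hb : b ≠ 0) (α β γ δ : ℂ) :
    HasNormalForm (singularCubic 0 b 0 α β γ δ) := by
  by_cases hα : α = 0
  · subst hα
    by_cases hγ : γ = 0
    · subst hγ
      refine hasNormalForm_x2y.of_linEquiv
        (linEquiv_of_eval !![0, 1, 0; δ, β, b; 1, 0, 0] ?_ fun x y z => ?_)
      · rw [Matrix.det_fin_three]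
        simpa using hb
      · simp [singularCubic, binaryCubic, eval_ternaryCubic]
        ring
    · obtain ⟨ρ, hρ⟩ := IsAlgClosed.exists_pow_nat_eq γ (n := 2) (by norm_num)
      have hρ0 : ρ ≠ 0 := by rintro rfl; simp at hρ; exact hγ hρ.symm
      refine (Table.conicPlusTangentLine.hasNormalForm conicPlusTangentLine_eq).of_linEquiv
        (linEquiv_of_eval !![ρ, 0, 0; 0, 1, 0; δ, β, b] ?_ fun x y z => ?_)
      · rw [Matrix.det_fin_three]
        simpa using ⟨hρ0, hb⟩
      · simp [singularCubic, eval_ternaryCubic]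
        linear_combination -x ^ 2 * y * hρ
  · obtain ⟨ρ, hρ⟩ := IsAlgClosed.exists_pow_nat_eq (-α) (n := 3) (by norm_num)
    have hρ0 : ρ ≠ 0 := by rintro rfl; simp at hρ; exact hα hρ
    obtain ⟨e, he⟩ : ∃ e, 3 * α * e = γ := ⟨γ / (3 * α), by field_simp⟩
    refine (hasNormalForm_weierstrass 0 0).of_linEquiv
      (linEquiv_of_eval !![ρ, ρ * e, 0; 0, 1, 0; δ - 3 * α * e ^ 2, β - α * e ^ 3, b] ?_
        fun x y z => ?_)
    · rw [Matrix.det_fin_three]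
      simpa using ⟨hρ0, hb⟩
    · simp [singularCubic, weierstrass, eval_ternaryCubic]
      linear_combination (x + e * y) ^ 3 * hρ - x ^ 2 * y * he

theorem hasNormalForm_singularCubic_of_ne_zero {b : ℂ} (hb : b ≠ 0) (a d α β γ δ : ℂ) :
    HasNormalForm (singularCubic a b d α β γ δ) := by
  obtain ⟨e, he⟩ : ∃ e, 2 * b * e = d := ⟨d / (2 * b), by field_simp⟩
  have hequiv : LinEquiv (singularCubic a b d α β γ δ) (singularCubic (a - b * e ^ 2) b 0
      (α - β * e ^ 3 - γ * e + δ * e ^ 2) β (γ + 3 * β * e ^ 2 - 2 * δ * e)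
      (δ - 3 * β * e)) := by
    refine linEquiv_of_eval !![1, 0, 0; e, 1, 0; 0, 0, 1] ?_ fun x y z => ?_
    · rw [Matrix.det_fin_three]
      simp
    · simp [singularCubic, eval_ternaryCubic]
      linear_combination -x * y * z * he
  refine HasNormalForm.of_linEquiv ?_ hequiv
  generalize a - b * e ^ 2 = a, α - β * e ^ 3 - γ * e + δ * e ^ 2 = α,
    γ + 3 * β * e ^ 2 - 2 * δ * e = γ, δ - 3 * β * e = δ
  by_cases ha : a = 0
  · subst ha
    exact hasNormalForm_singularCubic_sq hb _ _ _ _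
  -- Substituting s(x + y) and t(x − y) turns ax² + by² into ((x + y)² − (x − y)²)/4 = xy.
  · obtain ⟨s, hs⟩ := IsAlgClosed.exists_pow_nat_eq (1 / (4 * a)) (n := 2) (by norm_num)
    obtain ⟨t, ht⟩ := IsAlgClosed.exists_pow_nat_eq (-1 / (4 * b)) (n := 2) (by norm_num)
    have hs' : 4 * a * s ^ 2 = 1 := by rw [hs]; field_simp
    have ht' : 4 * b * t ^ 2 = -1 := by rw [ht]; field_simp
    have hs0 : s ≠ 0 := by rintro rfl; simp at hs'
    have ht0 : t ≠ 0 := by rintro rfl; simp at ht'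
    refine (hasNormalForm_singularCubic_xy one_ne_zero
      (α * s ^ 3 + β * t ^ 3 + γ * s ^ 2 * t + δ * s * t ^ 2)
      (α * s ^ 3 - β * t ^ 3 - γ * s ^ 2 * t + δ * s * t ^ 2)
      (3 * α * s ^ 3 - 3 * β * t ^ 3 + γ * s ^ 2 * t - δ * s * t ^ 2)
      (3 * α * s ^ 3 + 3 * β * t ^ 3 - γ * s ^ 2 * t - δ * s * t ^ 2)).of_linEquiv (LinEquiv.symm
      (linEquiv_of_eval !![s, s, 0; t, -t, 0; 0, 0, 1] ?_ fun x y z => ?_))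
    · have : (!![s, s, 0; t, -t, 0; 0, 0, 1] : Matrix (Fin 3) (Fin 3) ℂ).det = -2 * s * t := by
        rw [Matrix.det_fin_three]
        simp
        ring
      rw [this]
      exact mul_ne_zero (mul_ne_zero (by norm_num) hs0) ht0
    · simp [singularCubic, eval_ternaryCubic]
      linear_combination -(x + y) ^ 2 * z / 4 * hs' - (x - y) ^ 2 * z / 4 * ht'

theorem hasNormalForm_singularCubic {a b d α β γ δ : ℂ} (h : singularCubic a b d α β γ δ ≠ 0) :
    HasNormalForm (singularCubic a b d α β γ δ) := by
  by_cases hb : b = 0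
  · by_cases ha : a = 0
    · subst ha hb
      by_cases hd : d = 0
      · subst hd
        refine hasNormalForm_binaryCubic ?_
        by_contra! h0
        obtain ⟨rfl, rfl, rfl, rfl⟩ := h0
        exact h (MvPolynomial.funext fun p => by simp [singularCubic, eval_ternaryCubic])
      · exact hasNormalForm_singularCubic_xy hd _ _ _ _
    · exact (hasNormalForm_singularCubic_of_ne_zero ha _ _ _ _ _ _).of_linEquiv
        (linEquiv_singularCubic_swap ..)
  · exact hasNormalForm_singularCubic_of_ne_zero hb _ _ _ _ _ _

/-! ### Reduction of an arbitrary cubic -/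

theorem LinEquiv.ne_zero {φ ψ : MvPolynomial (Fin 3) ℂ} (h : LinEquiv φ ψ) (hφ : φ ≠ 0) :
    ψ ≠ 0 := by
  obtain ⟨g, rfl⟩ := h
  rintro rfl
  simp at hφ

/-- A matrix changes the coordinates of a ternary cubic. -/
theorem exists_ternaryCubic_comp (c : Fin 10 → ℂ) (N : Matrix (Fin 3) (Fin 3) ℂ) :
    ∃ c', ternaryCubic c' =
      bind₁ (fun i => linearForm fun j => N i j) (ternaryCubic c) := by
  refine ⟨_, (eq_ternaryCubic ?_).symm⟩
  simpa using (isHomogeneous_ternaryCubic c).aeval _ fun i => isHomogeneous_linearForm _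

theorem linEquiv_bind₁ {φ ψ : MvPolynomial (Fin 3) ℂ} {N : Matrix (Fin 3) (Fin 3) ℂ}
    (hN : N.det ≠ 0) (h : ψ = bind₁ (fun i => linearForm fun j => N i j) φ) : LinEquiv φ ψ :=
  LinEquiv.symm (linEquiv_iff.2 ⟨N, hN, fun p => by rw [h, eval_bind₁_linearForm]⟩)

theorem exists_det_ne_zero_mulVec_eq {p : Fin 3 → ℂ} (hp : p ≠ 0) :
    ∃ N : Matrix (Fin 3) (Fin 3) ℂ, N.det ≠ 0 ∧ N.mulVec ![0, 0, 1] = p := by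
  obtain ⟨i, hi⟩ := Function.ne_iff.1 hp
  have key (N : Matrix (Fin 3) (Fin 3) ℂ) (h : ∀ i, N i 2 = p i) : N.mulVec ![0, 0, 1] = p := by
    ext i
    simp [Matrix.mulVec, dotProduct, Fin.sum_univ_three, h]
  fin_cases i
  · refine ⟨!![0, 0, p 0; 1, 0, p 1; 0, 1, p 2], ?_, key _ fun i => by fin_cases i <;> rfl⟩
    simpa [Matrix.det_fin_three] using hi
  · refine ⟨!![1, 0, p 0; 0, 0, p 1; 0, 1, p 2], ?_, key _ fun i => by fin_cases i <;> rfl⟩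
    simpa [Matrix.det_fin_three] using hi
  · refine ⟨!![1, 0, p 0; 0, 1, p 1; 0, 0, p 2], ?_, key _ fun i => by fin_cases i <;> rfl⟩
    simpa [Matrix.det_fin_three] using hi

theorem hasNormalForm_of_singular {c : Fin 10 → ℂ} (hc : ternaryCubic c ≠ 0) {p : Fin 3 → ℂ}
    (hp : p ≠ 0) (hsing : ∀ i, eval p (pderiv i (ternaryCubic c)) = 0) :
    HasNormalForm (ternaryCubic c) := by
  obtain ⟨N, hN, hNp⟩ := exists_det_ne_zero_mulVec_eq hp
  obtain ⟨c', hc'⟩ := exists_ternaryCubic_comp c N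
  have hequiv := linEquiv_bind₁ hN hc'
  have hsing' (i) : eval ![0, 0, 1] (pderiv i (ternaryCubic c')) = 0 := by
    rw [hc', pderiv_bind₁_linearForm, map_sum]
    refine Finset.sum_eq_zero fun j _ => ?_
    rw [map_mul, eval_bind₁_linearForm, hNp, hsing, mul_zero]
  have h7 : c' 7 = 0 := by simpa [pderiv_zero_ternaryCubic] using hsing' 0
  have h8 : c' 8 = 0 := by simpa [pderiv_one_ternaryCubic] using hsing' 1
  have h2 : c' 2 = 0 := by simpa [pderiv_two_ternaryCubic] using hsing' 2
  have heq : ternaryCubic c' =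
      singularCubic (c' 4) (c' 6) (c' 9) (c' 0) (c' 1) (c' 3) (c' 5) :=
    MvPolynomial.funext fun p => by simp [singularCubic, eval_ternaryCubic, h2, h7, h8]
  have hne := hequiv.ne_zero hc
  rw [heq] at hne hequiv
  exact (hasNormalForm_singularCubic hne).of_linEquiv hequiv

/-- On z = 0 the form is c₀x³. If c₆ = 0, then (0 : 1 : 0) is singular. If c₀ = 0, the line z = 0 is
a component, singular where it meets the residual conic. Otherwise `hasNormalForm_flex` applies. -/
theorem hasNormalForm_of_inflection {c : Fin 10 → ℂ} (hc : ternaryCubic c ≠ 0) (h1 : c 1 = 0)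
    (h3 : c 3 = 0) (h5 : c 5 = 0) : HasNormalForm (ternaryCubic c) := by
  by_cases h6 : c 6 = 0
  · refine hasNormalForm_of_singular hc (p := ![0, 1, 0]) (fun h => by simpa using congrFun h 1)
      fun i => ?_
    fin_cases i
    · simp [pderiv_zero_ternaryCubic, h5]
    · simp [pderiv_one_ternaryCubic, h1]
    · simp [pderiv_two_ternaryCubic, h6]
  · by_cases h0 : c 0 = 0
    · obtain ⟨t, ht⟩ := IsAlgClosed.exists_root (Polynomial.C (c 6) * Polynomial.X ^ 2 +
        Polynomial.C (c 9) * Polynomial.X + Polynomial.C (c 4))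
        (by rw [Polynomial.degree_quadratic h6]; decide)
      have ht' : c 6 * t ^ 2 + c 9 * t + c 4 = 0 := by simpa [Polynomial.IsRoot] using ht
      refine hasNormalForm_of_singular hc (p := ![1, t, 0]) (fun h => by simpa using congrFun h 0)
        fun i => ?_
      fin_cases i
      · simp [pderiv_zero_ternaryCubic, h0, h3, h5]
      · simp [pderiv_one_ternaryCubic, h1, h3, h5]
      · simp [pderiv_two_ternaryCubic]
        linear_combination ht'
    · exact hasNormalForm_flex h1 h3 h5 h0 h6

theorem hessianAt_mulVec_self (c : Fin 10 → ℂ) (p : Fin 3 → ℂ) (i : Fin 3) :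
    (hessianAt (ternaryCubic c) p).mulVec p i = 2 * eval p (pderiv i (ternaryCubic c)) := by
  rw [hessianAt_ternaryCubic]
  fin_cases i <;> simp [Matrix.mulVec, dotProduct, Fin.sum_univ_three, pderiv_zero_ternaryCubic,
    pderiv_one_ternaryCubic, pderiv_two_ternaryCubic] <;> ring

theorem eval_add_smul_ternaryCubic (c : Fin 10 → ℂ) (p v : Fin 3 → ℂ) (t : ℂ) :
    eval (p + t • v) (ternaryCubic c) = eval p (ternaryCubic c)
      + t / 2 * dotProduct p ((hessianAt (ternaryCubic c) p).mulVec v)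
      + t ^ 2 / 2 * dotProduct v ((hessianAt (ternaryCubic c) p).mulVec v)
      + t ^ 3 * eval v (ternaryCubic c) := by
  rw [hessianAt_ternaryCubic]
  simp [eval_ternaryCubic, Matrix.mulVec, dotProduct, Fin.sum_univ_three]
  ring

/-- The curve and its Hessian curve intersect; if the Hessian determinant is identically zero, any
point of the curve serves. -/
theorem exists_hessian_kernel (c : Fin 10 → ℂ) : ∃ p v : Fin 3 → ℂ, p ≠ 0 ∧ v ≠ 0 ∧
    eval p (ternaryCubic c) = 0 ∧ (hessianAt (ternaryCubic c) p).mulVec v = 0 := by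
  let H : Matrix (Fin 3) (Fin 3) (MvPolynomial (Fin 3) ℂ) :=
    Matrix.of fun i j => pderiv i (pderiv j (ternaryCubic c))
  have hH (p : Fin 3 → ℂ) : eval p H.det = (hessianAt (ternaryCubic c) p).det := by
    rw [RingHom.map_det]
    rfl
  obtain ⟨p, hp, hp0, hpH⟩ := exists_common_zero (ternaryCubic c) H.det
    (by simp only [eval_ternaryCubic]; simp)
    (by rw [hH, hessianAt_ternaryCubic, Matrix.det_fin_three]; simp)
  rw [hH] at hpH
  obtain ⟨v, hv, hv0⟩ := Matrix.exists_mulVec_eq_zero_iff.2 hpH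
  exact ⟨p, v, hp, hv, hp0, hv0⟩

theorem hasNormalForm_of_linearIndependent {c : Fin 10 → ℂ} (hc : ternaryCubic c ≠ 0)
    {p v w : Fin 3 → ℂ} (hN : (Matrix.of ![v, p, w]).det ≠ 0) (hp0 : eval p (ternaryCubic c) = 0)
    (hv0 : (hessianAt (ternaryCubic c) p).mulVec v = 0) : HasNormalForm (ternaryCubic c) := by
  obtain ⟨c', hc'⟩ := exists_ternaryCubic_comp c (Matrix.of ![v, p, w]).transpose
  have hequiv := linEquiv_bind₁ (by rwa [Matrix.det_transpose]) hc'
  have key (t : ℂ) : c' 0 * t ^ 3 + c' 1 + c' 3 * t ^ 2 + c' 5 * t =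
      t ^ 3 * eval v (ternaryCubic c) := by
    have h1 := eval_add_smul_ternaryCubic c p v t
    rw [hv0, hp0, dotProduct_zero, dotProduct_zero] at h1
    have h2 : eval ![t, 1, 0] (ternaryCubic c') = eval (p + t • v) (ternaryCubic c) := by
      rw [hc', eval_bind₁_linearForm]
      congr 2
      ext i
      simp [Matrix.mulVec, dotProduct, Fin.sum_univ_three]
      ring
    rw [h1, eval_ternaryCubic] at h2
    simp at h2
    exact h2
  -- Four values of t separate the coefficients of two polynomials of degree at most three.
  have e0 := key 0
  have e1 := key 1
  have e2 := key (-1)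
  have e3 := key 2
  exact (hasNormalForm_of_inflection (hequiv.ne_zero hc) (by linear_combination e0)
    (by linear_combination (e1 + e2) / 2 - e0)
    (by linear_combination e1 - e2 / 3 - e0 / 2 - e3 / 6)).of_linEquiv hequiv

theorem hasNormalForm_ternaryCubic {c : Fin 10 → ℂ} (hc : ternaryCubic c ≠ 0) :
    HasNormalForm (ternaryCubic c) := by
  obtain ⟨p, v, hp, hv, hp0, hv0⟩ := exists_hessian_kernel c
  -- The vectors v and p are proportional exactly when no coordinate vector completes them to a
  -- basis. In that case p itself lies in the kernel of the Hessian, so the gradient vanishes at p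
  -- by Euler's relation.
  by_cases hall : ∀ k, (Matrix.of ![v, p, Pi.single k 1]).det = 0
  · have m0 := hall 0
    have m1 := hall 1
    have m2 := hall 2
    simp [Matrix.det_fin_three] at m0 m1 m2
    obtain ⟨i, hi⟩ := Function.ne_iff.1 hp
    have hvp : v = (v i / p i) • p := by
      have hmul : ∀ j, v j * p i = v i * p j := by
        intro j
        fin_cases i <;> fin_cases j <;> simp <;> grind
      ext j
      have : p i ≠ 0 := hi
      simp only [Pi.smul_apply, smul_eq_mul]
      field_simp
      exact hmul j
    have hr : v i / p i ≠ 0 := fun h => hv (by rw [hvp, h, zero_smul])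
    refine hasNormalForm_of_singular hc hp fun i => ?_
    rw [hvp, Matrix.mulVec_smul] at hv0
    have := congrFun ((smul_eq_zero.1 hv0).resolve_left hr) i
    rw [hessianAt_mulVec_self] at this
    simpa using this
  · push Not at hall
    obtain ⟨k, hk⟩ := hall
    exact hasNormalForm_of_linearIndependent hc hk hp0 hv0

/-! ### The curves defined by the normal forms -/

theorem describes_threeConcurrentLines :
    CurveType.threeConcurrentLines.Describes (X 0 * X 1 * (X 0 + X 1)) := by
  refine ⟨![1, 0, 0], ![0, 1, 0], ![1, 1, 0], linearIndependent_pair fun s t h => ?_,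
    linearIndependent_pair fun s t h => ?_, linearIndependent_pair fun s t h => ?_,
    ⟨![0, 0, 1], fun h => by simpa using congrFun h 2, ?_, ?_, ?_⟩,
    MvPolynomial.funext fun p => ?_⟩
  · simpa using And.intro (h 0) (h 1)
  · have h0 := h 0
    have h1 := h 1
    simp at h0 h1
    simpa [h1] using h0
  · have h0 := h 0
    have h1 := h 1
    simp at h0 h1
    simpa [h0] using h1
  all_goals simp [eval_linearForm, Fin.sum_univ_three]

theorem describes_irreducible (a b : ℂ) : CurveType.irreducible.Describes (weierstrass a b) := by
  rw [weierstrass_eq]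
  exact irreducible_generalWeierstrass one_ne_zero (by norm_num)

theorem describes_irreducibleSmooth {a b : ℂ} (h : 4 * a ^ 3 + 27 * b ^ 2 ≠ 0) :
    CurveType.irreducibleSmooth.Describes (weierstrass a b) := by
  refine ⟨describes_irreducible a b, ?_⟩
  rw [weierstrass_eq]
  refine smoothCurve_generalWeierstrass one_ne_zero (by norm_num) fun t h0 h1 => h ?_
  -- A double root t puts (a, b) on the parametrization (−3t², 2t³) of the discriminant curve.
  have ha : a = -3 * t ^ 2 := by linear_combination -h1
  have hb : b = 2 * t ^ 3 := by linear_combination -h0 - t * ha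
  rw [ha, hb]
  ring

theorem describes_irreducibleSingular {a : ℂ} (h : a ^ 3 = -27 / 4) :
    CurveType.irreducibleSingular.Describes (weierstrass a 1) := by
  refine ⟨describes_irreducible a 1, ?_⟩
  have ha0 : a ≠ 0 := by
    rintro rfl
    norm_num at h
  rw [weierstrass_eq]
  refine not_smoothCurve_generalWeierstrass (-3 / (2 * a)) ?_ ?_
  · field_simp
    linear_combination 4 * h
  · field_simp
    linear_combination -4 * h

theorem describes_cusp : CurveType.cusp.Describes (weierstrass 0 0) := by
  refine ⟨describes_irreducible 0 0, ![0, 0, 1], fun h => by simpa using congrFun h 2,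
    fun i => ?_, ?_⟩
  · rw [weierstrass]
    fin_cases i <;>
      simp [pderiv_zero_ternaryCubic, pderiv_one_ternaryCubic, pderiv_two_ternaryCubic]
  · have : hessianAt (weierstrass 0 0) ![0, 0, 1] = Matrix.diagonal ![0, 2, 0] := by
      rw [weierstrass, hessianAt_ternaryCubic]
      ext i j
      fin_cases i <;> fin_cases j <;> simp
    rw [this, Matrix.rank_diagonal, Fintype.card_eq_one_iff]
    refine ⟨⟨1, by simp⟩, ?_⟩
    rintro ⟨i, hi⟩
    fin_cases i <;> simp at hi ⊢

theorem describes_triangle : CurveType.triangle.Describes (X 0 * X 1 * X 2) := by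
  refine ⟨![1, 0, 0], ![0, 1, 0], ![0, 0, 1], linearIndependent_triple fun r s t h => ?_,
    MvPolynomial.funext fun p => ?_⟩
  · simpa using And.intro (h 0) (And.intro (h 1) (h 2))
  · simp [eval_linearForm, Fin.sum_univ_three]

theorem describes_conicPlusTransversalLine :
    CurveType.conicPlusTransversalLine.Describes (X 0 * (X 0 ^ 2 + X 1 * X 2)) := by
  obtain ⟨hirr, hhom⟩ := irreducible_conic (c := 1) (d := 1) one_ne_zero one_ne_zero
  refine ⟨![1, 0, 0], _, fun h => by simpa using congrFun h 0, hhom, hirr,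
    MvPolynomial.funext fun p => ?_, ![0, 1, 0], ![0, 0, 1],
    linearIndependent_pair fun s t h => ?_, ?_, ?_, ?_, ?_⟩
  · simp [eval_linearForm, Fin.sum_univ_three]
  · simpa using And.intro (h 1) (h 2)
  all_goals simp [eval_linearForm, Fin.sum_univ_three]

theorem describes_conicPlusTangentLine :
    CurveType.conicPlusTangentLine.Describes (X 1 * (X 0 ^ 2 + X 1 * X 2)) := by
  obtain ⟨hirr, hhom⟩ := irreducible_conic (c := 1) (d := 1) one_ne_zero one_ne_zero
  refine ⟨![0, 1, 0], _, fun h => by simpa using congrFun h 1, hhom, hirr,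
    MvPolynomial.funext fun p => ?_, ![0, 0, 1], fun h => by simpa using congrFun h 2, ?_, ?_,
    fun p hl hq => ⟨p 2, ?_⟩⟩
  · simp [eval_linearForm, Fin.sum_univ_three]
  · simp [eval_linearForm, Fin.sum_univ_three]
  · simp
  · have h1 : p 1 = 0 := by simpa [eval_linearForm, Fin.sum_univ_three] using hl
    have h0 : p 0 = 0 := by simpa [h1] using hq
    ext i
    fin_cases i <;> simp [h0, h1]

theorem Table.correct {row : Row} (h : Table row) :
    row.description.Describes row.normalForm ∧ waringRank 3 row.normalForm = row.rank ∧
      borderRank 3 row.normalForm = row.border ∧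
      ∀ T ∈ row.locus, DegenerateLocusIs row.normalForm T := by
  cases h with
  | tripleLine =>
    refine ⟨⟨![1, 0, 0], fun h => by simpa using congrFun h 0, by simp [linearForm, Fin.sum_univ_three]⟩,
      ?_, ?_, by simp⟩
    all_goals simp only [tripleLine_eq]
    exacts [ranks_tripleLine.1, ranks_tripleLine.2]
  | threeConcurrentLines =>
    refine ⟨describes_threeConcurrentLines, ?_, ?_, by simp⟩
    all_goals simp only [threeConcurrentLines_eq]
    exacts [ranks_threeConcurrentLines.1, ranks_threeConcurrentLines.2]
  | doubleLinePlusLine =>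
    refine ⟨⟨![1, 0, 0], ![0, 1, 0], linearIndependent_pair fun s t h => ?_, ?_⟩, ?_, ?_, by simp⟩
    · simpa using And.intro (h 0) (h 1)
    · simp [linearForm, Fin.sum_univ_three]
    all_goals simp only [doubleLinePlusLine_eq]
    exacts [ranks_doubleLinePlusLine.1, ranks_doubleLinePlusLine.2]
  | irreducible₁ =>
    simp only [irreducible₁_eq, Option.mem_some_iff, forall_eq']
    exact ⟨describes_irreducible 0 1, ranks_fermat.1, ranks_fermat.2, degenerateLocusIs_fermat⟩
  | irreducible₂ =>
    simp only [irreducible₂_eq, Option.mem_some_iff, forall_eq']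
    have h := degenerateLocusIs_weierstrass_smooth (a := 1) (b := 0) one_ne_zero (by norm_num)
    exact ⟨describes_irreducible 1 0, (ranks_weierstrass one_ne_zero).1,
      (ranks_weierstrass one_ne_zero).2, h.1, fun b => (h.2 b).2⟩
  | cusp =>
    simp only [cusp_eq, Option.mem_some_iff, forall_eq']
    exact ⟨describes_cusp, ranks_cusp.1, ranks_cusp.2, degenerateLocusIs_cusp⟩
  | triangle =>
    refine ⟨describes_triangle, ?_⟩
    simp only [triangle_eq, Option.mem_some_iff, forall_eq']
    exact ⟨ranks_triangle.1, ranks_triangle.2, degenerateLocusIs_triangle⟩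
  | conicPlusTransversalLine =>
    refine ⟨describes_conicPlusTransversalLine, ?_⟩
    simp only [conicPlusTransversalLine_eq, Option.mem_some_iff, forall_eq']
    exact ⟨ranks_conicPlusTransversalLine.1, ranks_conicPlusTransversalLine.2,
      degenerateLocusIs_conicPlusTransversalLine⟩
  | conicPlusTangentLine =>
    refine ⟨describes_conicPlusTangentLine, ?_⟩
    simp only [conicPlusTangentLine_eq, Option.mem_some_iff, forall_eq']
    exact ⟨ranks_conicPlusTangentLine.1, ranks_conicPlusTangentLine.2,
      degenerateLocusIs_conicPlusTangentLine⟩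
  | irreducibleSmooth a ha ha' =>
    have hdisc : 4 * a ^ 3 + 27 * (1 : ℂ) ^ 2 ≠ 0 := fun h => ha' (by linear_combination h / 4)
    simp only [weierstrass_one_eq, Option.mem_some_iff, forall_eq']
    exact ⟨describes_irreducibleSmooth hdisc, (ranks_weierstrass ha).1, (ranks_weierstrass ha).2,
      degenerateLocusIs_weierstrass_smooth ha hdisc⟩
  | irreducibleSingular a ha =>
    have ha0 : a ≠ 0 := by
      rintro rfl
      norm_num at ha
    simp only [weierstrass_one_eq, Option.mem_some_iff, forall_eq']
    exact ⟨describes_irreducibleSingular ha, (ranks_weierstrass ha0).1, (ranks_weierstrass ha0).2,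
      degenerateLocusIs_weierstrass_singular ha⟩

end PlaneCubic

end

theorem mainTheorem6 :
    -- every plane cubic is projectively equivalent to a normal form of the table
    (∀ φ : MvPolynomial (Fin 3) ℂ, φ.IsHomogeneous 3 → φ ≠ 0 →
      ∃ row : PlaneCubic.Row, PlaneCubic.Table row ∧ PlaneCubic.LinEquiv φ row.normalForm) ∧
    -- every row of the table is correct
    (∀ row : PlaneCubic.Row, PlaneCubic.Table row →
      row.description.Describes row.normalForm ∧
      PlaneCubic.waringRank 3 row.normalForm = row.rank ∧
      PlaneCubic.borderRank 3 row.normalForm = row.border ∧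
      (∀ T ∈ row.locus, PlaneCubic.DegenerateLocusIs row.normalForm T)) ∧
    -- rank and border rank of every cubic are those of its normal form
    (∀ row : PlaneCubic.Row, PlaneCubic.Table row →
      ∀ φ : MvPolynomial (Fin 3) ℂ, PlaneCubic.LinEquiv φ row.normalForm →
        PlaneCubic.waringRank 3 φ = row.rank ∧ PlaneCubic.borderRank 3 φ = row.border) := by
  refine ⟨fun φ hφ h0 => ?_, fun row h => h.correct, fun row h φ hφ => ?_⟩
  · rw [PlaneCubic.eq_ternaryCubic hφ] at h0 ⊢
    exact PlaneCubic.hasNormalForm_ternaryCubic h0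
  · rw [hφ.waringRank_eq, hφ.borderRank_eq]
    exact ⟨h.correct.2.1, h.correct.2.2.1⟩
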